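/- **Conventions.** For a probability distribution $D$ over a domain $X$ and an integer $n\ge 1$, a $\mathrm{VSTAT}_D(n)$ oracle answers each query, a measurable function $\phi:X\to[0,1]$, by some value $v$ with $|v-p|\le\max\{1/n,\sqrt{p(1-p)/n}\}$, where $p=\mathbb E_{z\sim D}[\phi(z)]$; the answers may be chosen adversarially and adaptively. A statistical query algorithm has access to $D$ only through such an oracle. Algorithms are programs of a real random access machine (unit-cost $+,-,\times,/$ and comparisons of reals; unit-cost addition, truncated subtraction, multiplication and comparison of natural numbers; no rounding). Each query function is given by such a program, without queries of its own, that computes $\phi(z)$ from the current memory and $z$; a query is charged the worst-case time of that program over $z\in X$. Write $B_2^d(R)=\{x\in\mathbb R^d:\|x\|_2\le R\}$. **Theorem.** There are a single program (Margin-Perceptron-SQ) and an absolute constant $C\in\mathbb N$ such that for every $d$ the following holds for at least $2/3$ of all strings $s\in\{0,1\}^{Cd^{C}}$ of random bits. For all real $R,W$, all $\gamma,\varepsilon>0$, every probability distribution $D$ over $B_2^d(R)\times\{\pm1\}$ for which there is a vector $w^*\in B_2^d(W)$ with $y\langle w^*,x\rangle\ge\gamma$ for $D$-almost every $(x,y)$,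 and every $\mathrm{VSTAT}_D(n)$ oracle with $$n=\left\lceil \frac{C\,(WR/\gamma)^2}{\varepsilon}\right\rceil ,$$ the program, on input $(d,R,W,\gamma,\varepsilon,s)$, halts with an output $w\in\mathbb R^d$ such that $$\Pr_{(x,y)\sim D}\left[y\langle w,x\rangle<\gamma/2\right]\le\varepsilon ,$$ after at most $C\,d\,(WR/\gamma)^2$ queries and at most $C\,(d+WR/\gamma+1/\varepsilon)^{C}$ steps. The random bits are thus used only for a choice that depends on $d$ alone: each good string $s$ makes the algorithm a deterministic one that is correct for all $R,W,\gamma,\varepsilon$, all $D$ and all oracle answers. In particular for every $d$ there is such a deterministic algorithm, with estimation complexity $O((WR/\gamma)^2/\varepsilon)$ independent of $d$. -/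

import Mathlib

open MeasureTheory

namespace SQ

/-! ### A real random access machine

Programs act on finitely many integer registers and finitely many real arrays. Integers may be
added, subtracted (truncated at zero) and multiplied; reals may be added, subtracted, multiplied
and divided; both may be compared. There is no rounding, no root and no non-integer constant. -/

/-- Memory: register `r` holds the natural number `nat r`, cell `i` of the array `a` holds the
real number `real a i`. -/
structure Mem where
  nat : ℕ → ℕ
  real : ℕ → ℕ → ℝ

namespace Mem

def setNat (m : Mem) (r v : ℕ) : Mem :=
  { m with nat := Function.update m.nat r v }

noncomputable def setReal (m : Mem) (a i : ℕ) (v : ℝ) : Mem :=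
  { m with real := Function.update m.real a (Function.update (m.real a) i v) }

noncomputable def setArray (m : Mem) (a : ℕ) (f : ℕ → ℝ) : Mem :=
  { m with real := Function.update m.real a f }

end Mem

/-- Integer expressions. -/
inductive NExpr where
  | lit (n : ℕ)
  | reg (r : ℕ)
  | add (e₁ e₂ : NExpr)
  | sub (e₁ e₂ : NExpr)
  | mul (e₁ e₂ : NExpr)

def NExpr.eval (m : Mem) : NExpr → ℕ
  | lit n => n
  | reg r => m.nat r
  | add e₁ e₂ => e₁.eval m + e₂.eval m
  | sub e₁ e₂ => e₁.eval m - e₂.eval m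
  | mul e₁ e₂ => e₁.eval m * e₂.eval m

/-- Real expressions; `cell a e` reads the array `a` at the index `e`. -/
inductive RExpr where
  | ofNat (e : NExpr)
  | cell (a : ℕ) (e : NExpr)
  | add (e₁ e₂ : RExpr)
  | sub (e₁ e₂ : RExpr)
  | mul (e₁ e₂ : RExpr)
  | div (e₁ e₂ : RExpr)

/-- Division by zero returns zero. -/
noncomputable def RExpr.eval (m : Mem) : RExpr → ℝ
  | ofNat e => (e.eval m : ℝ)
  | cell a e => m.real a (e.eval m)
  | add e₁ e₂ => e₁.eval m + e₂.eval m
  | sub e₁ e₂ => e₁.eval m - e₂.eval m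
  | mul e₁ e₂ => e₁.eval m * e₂.eval m
  | div e₁ e₂ => e₁.eval m / e₂.eval m

/-- Tests. -/
inductive Test where
  | natLt (e₁ e₂ : NExpr)
  | realLt (e₁ e₂ : RExpr)
  | neg (b : Test)
  | both (b₁ b₂ : Test)

def Test.Holds (m : Mem) : Test → Prop
  | natLt e₁ e₂ => e₁.eval m < e₂.eval m
  | realLt e₁ e₂ => e₁.eval m < e₂.eval m
  | neg b => ¬ b.Holds m
  | both b₁ b₂ => b₁.Holds m ∧ b₂.Holds m

/-- Programs that may ask questions of type `Q`. `ask q a e` asks `q` and stores the (real) answer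
in cell `e` of the array `a`; `loop b c` is "while `b` do `c`". -/
inductive Prog (Q : Type) where
  | skip
  | nset (r : ℕ) (e : NExpr)
  | rset (a : ℕ) (i : NExpr) (e : RExpr)
  | seq (c₁ c₂ : Prog Q)
  | cond (b : Test) (c₁ c₂ : Prog Q)
  | loop (b : Test) (c : Prog Q)
  | ask (q : Q) (a : ℕ) (e : NExpr)

/-- `Exec H c m k t m' k'`: started in memory `m` after `k` questions have been asked, the program
`c` halts after `t` steps in memory `m'`, and `k'` questions have been asked by then. Here
`H k q m t v` says that question `q`, asked in memory `m` after `k` earlier questions, costs `t`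
steps and is answered by `v`. Every assignment and every evaluation of a test is one step (the
expressions in a program have a fixed size, so this counts arithmetic operations up to a constant
factor that depends only on the program). -/
inductive Exec {Q : Type} (H : ℕ → Q → Mem → ℕ → ℝ → Prop) :
    Prog Q → Mem → ℕ → ℕ → Mem → ℕ → Prop where
  | skip (m : Mem) (k : ℕ) : Exec H Prog.skip m k 1 m k
  | nset (r : ℕ) (e : NExpr) (m : Mem) (k : ℕ) :
      Exec H (Prog.nset r e) m k 1 (m.setNat r (e.eval m)) k
  | rset (a : ℕ) (i : NExpr) (e : RExpr) (m : Mem) (k : ℕ) :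
      Exec H (Prog.rset a i e) m k 1 (m.setReal a (i.eval m) (e.eval m)) k
  | seq {c₁ c₂ : Prog Q} {m m₁ m₂ : Mem} {k k₁ k₂ t₁ t₂ : ℕ} :
      Exec H c₁ m k t₁ m₁ k₁ → Exec H c₂ m₁ k₁ t₂ m₂ k₂ →
      Exec H (Prog.seq c₁ c₂) m k (t₁ + t₂) m₂ k₂
  | condTrue {b : Test} {c₁ c₂ : Prog Q} {m m' : Mem} {k k' t : ℕ} :
      b.Holds m → Exec H c₁ m k t m' k' → Exec H (Prog.cond b c₁ c₂) m k (t + 1) m' k'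
  | condFalse {b : Test} {c₁ c₂ : Prog Q} {m m' : Mem} {k k' t : ℕ} :
      ¬ b.Holds m → Exec H c₂ m k t m' k' → Exec H (Prog.cond b c₁ c₂) m k (t + 1) m' k'
  | loopDone {b : Test} {c : Prog Q} {m : Mem} {k : ℕ} :
      ¬ b.Holds m → Exec H (Prog.loop b c) m k 1 m k
  | loopStep {b : Test} {c : Prog Q} {m m₁ m₂ : Mem} {k k₁ k₂ t₁ t₂ : ℕ} :
      b.Holds m → Exec H c m k t₁ m₁ k₁ → Exec H (Prog.loop b c) m₁ k₁ t₂ m₂ k₂ →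
      Exec H (Prog.loop b c) m k (t₁ + t₂ + 1) m₂ k₂
  | ask {q : Q} {a : ℕ} {e : NExpr} {m : Mem} {k t : ℕ} {v : ℝ} :
      H k q m t v → Exec H (Prog.ask q a e) m k (t + 1) (m.setReal a (e.eval m) v) (k + 1)

/-- Programs without questions. -/
abbrev Code : Type := Prog Empty

/-- The code `c`, started in memory `m`, halts after `t` steps in memory `m'`. -/
def Code.Run (c : Code) (m : Mem) (t : ℕ) (m' : Mem) : Prop :=
  Exec (fun _ _ _ _ _ => False) c m 0 t m' 0

/-! ### Statistical queries -/

/-- The example space `B₂ᵈ(R) × {±1}`. -/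
abbrev Example (d : ℕ) (R : ℝ) : Type :=
  Metric.closedBall (0 : EuclideanSpace ℝ (Fin d)) R × ℤˣ

/-- `y ⟨w, x⟩` for the example `z = (x, y)`. -/
noncomputable def margin {d : ℕ} {R : ℝ} (w : EuclideanSpace ℝ (Fin d)) (z : Example d R) : ℝ :=
  ((z.2 : ℤ) : ℝ) * inner ℝ w (z.1 : EuclideanSpace ℝ (Fin d))

/-- `O k φ` is the answer to the query `φ` if it is the `k`-th query that is asked, so the answers
may be chosen adversarially and adaptively. `O` is a `VSTAT_D(n)` oracle if all these answers are
within the tolerance of `VSTAT_D(n)`. -/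
def IsVSTAT {X : Type*} [MeasurableSpace X] (D : Measure X) (n : ℕ)
    (O : ℕ → (X → ℝ) → ℝ) : Prop :=
  ∀ (k : ℕ) (φ : X → ℝ), Measurable φ → (∀ z, φ z ∈ Set.Icc (0 : ℝ) 1) →
    |O k φ - ∫ z, φ z ∂D| ≤
      max (1 / (n : ℝ)) (Real.sqrt ((∫ z, φ z ∂D) * (1 - ∫ z, φ z ∂D) / n))

/-- Memory layout: array 0 holds `R, W, γ, ε`. -/
def paramArr : ℕ := 0
/-- Memory layout: the array of the random bits. -/
def seedArr : ℕ := 1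
/-- Memory layout: the array in which the output vector is left. -/
def outArr : ℕ := 2
/-- Memory layout: the array of the coordinates of `x`, for code that evaluates a query. -/
def pointArr : ℕ := 3
/-- Memory layout: the array whose cell 0 is the label `y`, for code that evaluates a query. -/
def labelArr : ℕ := 4
/-- Memory layout: the array whose cell 0 receives the value of a query. -/
def valueArr : ℕ := 5

/-- A vector as the content of an array. -/
noncomputable def arrayOf {d : ℕ} (x : EuclideanSpace ℝ (Fin d)) (i : ℕ) : ℝ :=
  if h : i < d then x ⟨i, h⟩ else 0

/-- The memory `m` with the example `z` put into the places reserved for it. -/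
noncomputable def loadExample {d : ℕ} {R : ℝ} (m : Mem) (z : Example d R) : Mem :=
  (m.setArray pointArr (arrayOf (z.1 : EuclideanSpace ℝ (Fin d)))).setReal labelArr 0
    ((z.2 : ℤ) : ℝ)

/-- A statistical query program: its questions are codes of query functions. -/
abbrev SQProgram : Type := Prog Code

/-- A question `c`, asked in memory `m`, is the query function `φ` on the example space whose value
at `z` is computed by `c` from `m` and `z`. It has to be `[0,1]`-valued, it is charged (a bound on)
the time that `c` takes on the worst example, and it is answered by the oracle `O`. The examples are
visible only to `c`, and the memory that `c` leaves is discarded. -/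
def Answers {d : ℕ} {R : ℝ} (O : ℕ → (Example d R → ℝ) → ℝ)
    (k : ℕ) (c : Code) (m : Mem) (t : ℕ) (v : ℝ) : Prop :=
  ∃ φ : Example d R → ℝ,
    (∀ z, φ z ∈ Set.Icc (0 : ℝ) 1) ∧
    (∀ z, ∃ t' ≤ t, ∃ m' : Mem, c.Run (loadExample m z) t' m' ∧ m'.real valueArr 0 = φ z) ∧
    v = O k φ

/-- The initial memory: the dimension `d` in register 0, the numbers `R, W, γ, ε` in cells 0 to 3
of the parameter array, the random bits (as 0 and 1) in the seed array, and zero elsewhere. -/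
noncomputable def initMem (d : ℕ) (R W γ ε : ℝ) {l : ℕ} (seed : Fin l → Bool) : Mem where
  nat r := if r = 0 then d else 0
  real a i :=
    if a = paramArr then
      (if i = 0 then R else if i = 1 then W else if i = 2 then γ else if i = 3 then ε else 0)
    else if a = seedArr then
      (if h : i < l then (if seed ⟨i, h⟩ then 1 else 0) else 0)
    else 0

/-- On input `d, R, W, γ, ε` and the given random bits, and with its queries answered by `O`, the
program `P` halts after `t` steps and `q` queries with output `w`. -/
def Outputs (P : SQProgram) {d : ℕ} {R : ℝ} (W γ ε : ℝ) {l : ℕ} (seed : Fin l → Bool)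
    (O : ℕ → (Example d R → ℝ) → ℝ) (t q : ℕ) (w : EuclideanSpace ℝ (Fin d)) : Prop :=
  ∃ m' : Mem, Exec (Answers O) P (initMem d R W γ ε seed) 0 t m' q ∧
    ∀ i : Fin d, w i = m'.real outArr i

end SQ

namespace SQ

/-! ### Random sign vectors -/

/-! The algorithm is a perceptron on averages. Let `p` be the mass of the examples of margin below
`γ / 2`, and `κ = W R / γ`. The integral of `y x` over these examples has inner product at least `p
γ` with `w*` and at most `p γ / 2` with `w`, so a step along it of size about `γ / (8 R² p)` lowers
`‖w - w*‖²` by `γ² / (32 R²)`, even if the integral is known only up to a relative error of order `1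
/ κ` (`norm_perceptron_step_le`). Starting from `w = 0`, at most `32 κ²` steps are possible.

The difficulty is to estimate this vector in Euclidean norm without losing a power of `d`: errors
`η` in orthonormal coordinates may add up to `η √d`. The remedy is a redundant system of `N = 2000
d` vectors `b i` for which `∑ |⟨b i, u⟩|` is comparable to `N ‖u‖` (`IsKashin`). By duality, the
upper bound says that errors of size `η / N` in the coefficients move the combination by at most `3
η` (`IsKashin.norm_sum_smul_le`). The lower bound says that a residual `r` correlates well with `∑
sgn ⟨b i, r⟩ • b i`, so that subtracting a small multiple of this sum shrinks the bound on the
residual by a fixed factor (`IsKashin.norm_step_le`). Iteration expands every `x` of the ball with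
coefficients `O(R / N)`. Each coefficient, moved into `[0, 1]` and restricted to the examples of
small margin, is one query. Its mean is at most `p`, so its tolerance is of order `√(p / n)`, which
for `p ≥ ε / 4` is at most `p / (500000 κ)` (`tolerance_le`).

Rows of random signs form such a system with probability at least `2 / 3` (`card_isKashin_ge`): the
upper bound is a union bound over sign patterns, the lower one a union bound over integer points
followed by rounding. The event concerns `d` and the bits only, hence one good string serves all
distributions and oracles.

The rest is a total-correctness calculus with step counts (`Runs`), applied to an explicit program.
-/

theorem sum_bool_pi_prod {ι : Type*} [Fintype ι] [DecidableEq ι] {R : Type*} [CommSemiring R]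
    (f : ι → Bool → R) :
    ∑ e : ι → Bool, ∏ j, f j (e j) = ∏ j, (f j true + f j false) := by
  have h := Finset.sum_prod_piFinset (Finset.univ : Finset Bool) f
  rw [Fintype.piFinset_univ] at h
  rw [h]
  exact Finset.prod_congr rfl fun j _ => by simp

/-- The sign vector given by a string of bits. -/
noncomputable def signVec {d : ℕ} (e : Fin d → Bool) : EuclideanSpace ℝ (Fin d) :=
  WithLp.toLp 2 fun j => if e j then 1 else -1

theorem norm_signVec_sq {d : ℕ} (e : Fin d → Bool) : ‖signVec e‖ ^ 2 = d := by
  rw [EuclideanSpace.norm_sq_eq]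
  have : ∀ j : Fin d, ‖(signVec e).ofLp j‖ ^ 2 = 1 := by
    intro j
    simp only [signVec]
    split_ifs <;> simp
  rw [Finset.sum_congr rfl fun j _ => this j]
  simp

theorem inner_signVec {d : ℕ} (e : Fin d → Bool) (u : EuclideanSpace ℝ (Fin d)) :
    inner ℝ (signVec e) u = ∑ j, (if e j then 1 else -1) * u j := by
  rw [PiLp.inner_apply]
  exact Finset.sum_congr rfl fun j _ => by simp [signVec, mul_comm]

/-! ### Upper bound on the `ℓ₁` sums, by exponential moments -/

/-- Signs are subgaussian: the sum factorizes into `2 cosh (u j)`, and `cosh t ≤ exp (t² / 2)`. -/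
theorem sum_exp_inner_signVec_le {d : ℕ} (u : EuclideanSpace ℝ (Fin d)) :
    ∑ e : Fin d → Bool, Real.exp (inner ℝ (signVec e) u) ≤
      2 ^ d * Real.exp (‖u‖ ^ 2 / 2) := by
  have h1 : ∀ e : Fin d → Bool, Real.exp (inner ℝ (signVec e) u) =
      ∏ j, Real.exp ((if e j then 1 else -1) * u j) := by
    intro e
    rw [inner_signVec, Real.exp_sum]
  simp_rw [h1]
  rw [sum_bool_pi_prod (fun j b => Real.exp ((if b then 1 else -1) * u j))]
  have h2 : (2 : ℝ) ^ d * Real.exp (‖u‖ ^ 2 / 2) = ∏ j, 2 * Real.exp (u j ^ 2 / 2) := by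
    rw [Finset.prod_mul_distrib, ← Real.exp_sum, EuclideanSpace.norm_sq_eq, Finset.sum_div]
    simp
  rw [h2]
  refine Finset.prod_le_prod (fun j _ => by positivity) fun j _ => ?_
  have h3 := Real.cosh_le_exp_half_sq (u j)
  rw [Real.cosh_eq] at h3
  simp only [if_true, one_mul, Bool.false_eq_true, if_false, neg_mul]
  linarith

/-- Expanding the square leaves a term linear in the signs. Its subgaussian bound `2 a² ‖v‖²` is
what turns `a` into `a (1 + 2 a)`. -/
theorem sum_exp_norm_add_signVec_sq_le {d : ℕ} (v : EuclideanSpace ℝ (Fin d)) {s a : ℝ}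
    (hs : s ^ 2 = 1) :
    ∑ e : Fin d → Bool, Real.exp (a * ‖v + s • signVec e‖ ^ 2) ≤
      2 ^ d * Real.exp (a * d + a * (1 + 2 * a) * ‖v‖ ^ 2) := by
  have h1 : ∀ e : Fin d → Bool, Real.exp (a * ‖v + s • signVec e‖ ^ 2) =
      Real.exp (a * d + a * ‖v‖ ^ 2) * Real.exp (inner ℝ (signVec e) ((2 * a * s) • v)) := by
    intro e
    rw [← Real.exp_add, norm_add_sq_real, norm_smul, mul_pow, norm_signVec_sq, Real.norm_eq_abs,
      sq_abs, hs, inner_smul_right, inner_smul_right, real_inner_comm]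
    ring_nf
  simp_rw [h1]
  rw [← Finset.mul_sum]
  refine (mul_le_mul_of_nonneg_left (sum_exp_inner_signVec_le _) (Real.exp_nonneg _)).trans
    (le_of_eq ?_)
  rw [mul_left_comm, ← Real.exp_add, norm_smul, mul_pow, Real.norm_eq_abs, sq_abs]
  congr 2
  linear_combination (2 * a ^ 2 * ‖v‖ ^ 2) * hs

/-- Splitting off one vector replaces `a` by `a (1 + 2 a)`, so the induction runs over all `a`. The
condition `4 a N ≤ 1` survives, as the increase `8 a² N ≤ 2 a` is less than the `4 a` that is freed.
-/
theorem sum_exp_norm_sum_signVec_sq_le {d : ℕ} (N : ℕ) (s : Fin N → ℝ) (hs : ∀ i, s i ^ 2 = 1)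
    (a : ℝ) (ha : 0 ≤ a) (haN : 4 * a * N ≤ 1) :
    ∑ ω : Fin N → Fin d → Bool, Real.exp (a * ‖∑ i, s i • signVec (ω i)‖ ^ 2) ≤
      (2 ^ d) ^ N * Real.exp (2 * a * d * N) := by
  induction N generalizing a with
  | zero => simp
  | succ N ih =>
    rw [← Fintype.sum_equiv (Fin.consEquiv fun _ => Fin d → Bool)
      (fun p : (Fin d → Bool) × (Fin N → Fin d → Bool) =>
        Real.exp (a * ‖(∑ i, s i.succ • signVec (p.2 i)) + s 0 • signVec p.1‖ ^ 2)) _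
      (fun p => by simp [Fin.consEquiv, Fin.sum_univ_succ, add_comm])]
    rw [Fintype.sum_prod_type_right]
    push_cast at haN
    have hb : 4 * (a * (1 + 2 * a)) * N ≤ 1 := by
      have : (0 : ℝ) ≤ N := N.cast_nonneg
      nlinarith [mul_nonneg ha this]
    calc _ ≤ ∑ ω : Fin N → Fin d → Bool, 2 ^ d * Real.exp (a * d +
            a * (1 + 2 * a) * ‖∑ i, s i.succ • signVec (ω i)‖ ^ 2) :=
          Finset.sum_le_sum fun ω _ => sum_exp_norm_add_signVec_sq_le _ (hs 0)
      _ = 2 ^ d * Real.exp (a * d) * ∑ ω : Fin N → Fin d → Bool,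
            Real.exp (a * (1 + 2 * a) * ‖∑ i, s i.succ • signVec (ω i)‖ ^ 2) := by
          rw [Finset.mul_sum]
          exact Finset.sum_congr rfl fun ω _ => by rw [Real.exp_add]; ring
      _ ≤ 2 ^ d * Real.exp (a * d) * ((2 ^ d) ^ N *
            Real.exp (2 * (a * (1 + 2 * a)) * d * N)) :=
          mul_le_mul_of_nonneg_left (ih _ (fun i => hs i.succ) _ (by positivity) hb)
            (by positivity)
      _ = (2 ^ d) ^ (N + 1) * Real.exp (a * d + 2 * (a * (1 + 2 * a)) * d * N) := by
          rw [Real.exp_add]; ring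
      _ ≤ _ := by
          refine mul_le_mul_of_nonneg_left (Real.exp_le_exp.2 ?_) (by positivity)
          push_cast
          have h0 : (0 : ℝ) ≤ d := d.cast_nonneg
          have h1 : (0 : ℝ) ≤ N := N.cast_nonneg
          have : a * d * (4 * a * N) ≤ a * d * 1 :=
            mul_le_mul_of_nonneg_left (by nlinarith) (by positivity)
          nlinarith

/-- Markov's inequality in counting form. -/
theorem card_filter_le_of_sum_exp {α : Type*} [Fintype α] (f : α → ℝ) (t B : ℝ)
    (h : ∑ ω, Real.exp (f ω) ≤ B) :
    ((Finset.univ.filter fun ω => t ≤ f ω).card : ℝ) ≤ B * Real.exp (-t) := by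
  classical
  rw [Real.exp_neg, ← div_eq_mul_inv, le_div_iff₀ (Real.exp_pos t), ← nsmul_eq_mul]
  refine le_trans ?_ h
  refine (Finset.card_nsmul_le_sum _ (fun ω => Real.exp (f ω)) _ ?_).trans
    (Finset.sum_le_sum_of_subset_of_nonneg (Finset.filter_subset _ _)
      fun _ _ _ => Real.exp_nonneg _)
  intro ω hω
  exact Real.exp_le_exp.2 (Finset.mem_filter.1 hω).2

theorem card_norm_sum_signVec_gt_le {d N : ℕ} (hN : 0 < N) (s : Fin N → ℝ)
    (hs : ∀ i, s i ^ 2 = 1) :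
    ((Finset.univ.filter fun ω : Fin N → Fin d → Bool =>
      3 * (N : ℝ) < ‖∑ i, s i • signVec (ω i)‖).card : ℝ) ≤
      (2 ^ d) ^ N * Real.exp (d / 2 - 9 * N / 4) := by
  have hN' : (0 : ℝ) < N := by exact_mod_cast hN
  -- The largest admissible exponent is `a = 1 / (4 N)`, and then `a (3 N)² = 9 N / 4`.
  have h := card_filter_le_of_sum_exp _ (9 * N / 4)  _
    (sum_exp_norm_sum_signVec_sq_le (d := d) N s hs (1 / (4 * N)) (by positivity)
      (le_of_eq (by field_simp)))
  rw [mul_assoc, ← Real.exp_add] at h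
  have e : 2 * (1 / (4 * (N : ℝ))) * d * N + -(9 * N / 4) = d / 2 - 9 * N / 4 := by
    field_simp; ring
  rw [e] at h
  refine le_trans ?_ h
  refine Nat.cast_le.2 (Finset.card_le_card fun ω hω => ?_)
  simp only [Finset.mem_filter, Finset.mem_univ, true_and] at hω ⊢
  rw [div_mul_eq_mul_div, one_mul, le_div_iff₀ (by positivity)]
  nlinarith

/-- The sign of a real number, with value `1` at `0`. -/
noncomputable def sgn (t : ℝ) : ℝ := if t < 0 then -1 else 1

theorem abs_sgn (t : ℝ) : |sgn t| = 1 := by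
  unfold sgn; split_ifs <;> norm_num

theorem sgn_mul_self (t : ℝ) : sgn t * t = |t| := by
  unfold sgn
  split_ifs with h
  · rw [abs_of_neg h]; ring
  · rw [abs_of_nonneg (not_lt.1 h)]; ring

open Classical in
-- The sum of absolute values is the inner product of `u` with a signed sum of the rows, so only the
-- norms of the `2 ^ N ≤ exp N` signed sums matter; the tail `exp (-9 N / 4)` beats their number.
theorem card_not_upper_le {d N : ℕ} (hd : 1 ≤ d) (hN : 2000 * d ≤ N) :
    ((Finset.univ.filter fun ω : Fin N → Fin d → Bool =>
      ¬ ∀ u : EuclideanSpace ℝ (Fin d), ∑ i, |inner ℝ (signVec (ω i)) u| ≤ 3 * N * ‖u‖).card : ℝ) ≤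
      (2 ^ d) ^ N * (1 / 6) := by
  have hN0 : 0 < N := by omega
  let T : (Fin N → Bool) → Finset (Fin N → Fin d → Bool) := fun σ =>
    Finset.univ.filter fun ω =>
      3 * (N : ℝ) < ‖∑ i, (if σ i then (1 : ℝ) else -1) • signVec (ω i)‖
  have hsub : (Finset.univ.filter fun ω : Fin N → Fin d → Bool =>
      ¬ ∀ u : EuclideanSpace ℝ (Fin d), ∑ i, |inner ℝ (signVec (ω i)) u| ≤ 3 * N * ‖u‖) ⊆
      Finset.univ.biUnion T := by
    intro ω hω
    simp only [Finset.mem_filter, Finset.mem_univ, true_and, Finset.mem_biUnion, T] at hω ⊢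
    by_contra! hcon
    refine hω fun u => ?_
    have h1 := hcon fun i => decide (¬ inner ℝ (signVec (ω i)) u < 0)
    have h2 : ∀ i, (if decide (¬ inner ℝ (signVec (ω i)) u < 0) = true then (1 : ℝ) else -1) =
        sgn (inner ℝ (signVec (ω i)) u) := by
      intro i; unfold sgn; by_cases h : inner ℝ (signVec (ω i)) u < 0 <;> simp [h]
    simp only [h2] at h1
    calc ∑ i, |inner ℝ (signVec (ω i)) u|
        = inner ℝ (∑ i, sgn (inner ℝ (signVec (ω i)) u) • signVec (ω i)) u := by
          rw [sum_inner]
          exact Finset.sum_congr rfl fun i _ => by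
            rw [real_inner_smul_left, sgn_mul_self]
      _ ≤ _ := (real_inner_le_norm _ _).trans
          (mul_le_mul_of_nonneg_right h1 (norm_nonneg _))
  have hT : ∀ σ, ((T σ).card : ℝ) ≤ (2 ^ d) ^ N * Real.exp (d / 2 - 9 * N / 4) := fun σ =>
    card_norm_sum_signVec_gt_le hN0 _ fun i => by split_ifs <;> norm_num
  have h1 : ((Finset.univ.filter fun ω : Fin N → Fin d → Bool =>
      ¬ ∀ u : EuclideanSpace ℝ (Fin d), ∑ i, |inner ℝ (signVec (ω i)) u| ≤ 3 * N * ‖u‖).card : ℝ) ≤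
      ∑ σ, ((T σ).card : ℝ) := by
    exact_mod_cast (Finset.card_le_card hsub).trans Finset.card_biUnion_le
  refine h1.trans ((Finset.sum_le_sum fun σ _ => hT σ).trans ?_)
  rw [Finset.sum_const, nsmul_eq_mul, mul_left_comm]
  refine mul_le_mul_of_nonneg_left ?_ (by positivity)
  have h2 : ((Finset.univ : Finset (Fin N → Bool)).card : ℝ) = 2 ^ N := by simp
  rw [h2]
  have h3 : (2 : ℝ) ^ N ≤ Real.exp N := by
    rw [← mul_one (N : ℝ), Real.exp_nat_mul]
    exact pow_le_pow_left₀ (by norm_num) (by linarith [Real.add_one_le_exp (1 : ℝ)]) _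
  refine (mul_le_mul_of_nonneg_right h3 (Real.exp_nonneg _)).trans ?_
  rw [← Real.exp_add]
  have hNr : 2000 * (d : ℝ) ≤ N := by exact_mod_cast hN
  have hdr : (1 : ℝ) ≤ d := by exact_mod_cast hd
  have h4 : Real.exp ((N : ℝ) + (d / 2 - 9 * N / 4)) ≤ Real.exp (-5) :=
    Real.exp_le_exp.2 (by linarith)
  refine h4.trans ?_
  rw [Real.exp_neg, one_div]
  exact inv_anti₀ (by norm_num) (by linarith [Real.add_one_le_exp (5 : ℝ)])

/-! ### Lower bound in a fixed direction -/

/-- The point of this majorant is that the cosine, unlike `exp (-|t|)`, averages over sign vectors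
to a product. For `|t| ≤ 2` it follows from the quadratic lower bound on the cosine, beyond that
from `cos t ≥ -1`. -/
theorem exp_neg_abs_le (t : ℝ) : Real.exp (-|t|) ≤ 1 - (1 - Real.cos t) / 3 := by
  have h0 := abs_nonneg t
  have h1 : Real.exp (-|t|) ≤ 1 / (1 + |t|) := by
    rw [Real.exp_neg, one_div]
    exact inv_anti₀ (by linarith) (by linarith [Real.add_one_le_exp |t|])
  refine h1.trans ?_
  rw [div_le_iff₀ (by linarith)]
  have h2 := Real.one_sub_sq_div_two_le_cos (x := t)
  have h3 := Real.neg_one_le_cos t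
  rw [← sq_abs] at h2
  rcases le_total |t| 2 with h | h
  · nlinarith [mul_nonneg h0 (sub_nonneg.2 h), mul_nonneg h0 (mul_nonneg h0 (sub_nonneg.2 h))]
  · nlinarith

theorem cos_le_exp_neg_sq {x : ℝ} (hx : |x| ≤ 1) : Real.cos x ≤ Real.exp (-(11 / 25) * x ^ 2) := by
  have h1 := (abs_le.1 (Real.cos_bound hx)).2
  have h2 : |x| ^ 4 ≤ x ^ 2 := by
    rw [← sq_abs x]
    exact pow_le_pow_of_le_one (abs_nonneg x) hx (by norm_num)
  have h3 := Real.add_one_le_exp (-(11 / 25) * x ^ 2)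
  nlinarith [sq_nonneg x]

/-- Real part of the factorization of `exp (i ⟨e, u⟩)`. -/
theorem sum_cos_inner_signVec {d : ℕ} (u : EuclideanSpace ℝ (Fin d)) :
    ∑ e : Fin d → Bool, Real.cos (inner ℝ (signVec e) u) = 2 ^ d * ∏ j, Real.cos (u j) := by
  have h1 : ∀ j, Complex.exp ((((if true then 1 else -1) * u j : ℝ) : ℂ) * Complex.I) +
      Complex.exp ((((if false then 1 else -1) * u j : ℝ) : ℂ) * Complex.I) =
      ((2 * Real.cos (u j) : ℝ) : ℂ) := by
    intro j
    push_cast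
    rw [Complex.two_cos]
    simp
  have h2 : ∀ e : Fin d → Bool,
      ∏ j, Complex.exp ((((if e j then 1 else -1) * u j : ℝ) : ℂ) * Complex.I) =
      Complex.exp (((inner ℝ (signVec e) u : ℝ) : ℂ) * Complex.I) := by
    intro e
    rw [← Complex.exp_sum, ← Finset.sum_mul, inner_signVec, Complex.ofReal_sum]
  have h := ((Finset.sum_congr rfl fun e _ => (h2 e).symm).trans (sum_bool_pi_prod
    (fun (j : Fin d) b => Complex.exp
      ((((if b then 1 else -1) * u j : ℝ) : ℂ) * Complex.I)))).trans
    (Finset.prod_congr rfl fun j _ => h1 j)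
  have h3 := congrArg Complex.re h
  rw [Complex.re_sum, ← Complex.ofReal_prod, Complex.ofReal_re, Finset.prod_mul_distrib] at h3
  simpa [Complex.exp_ofReal_mul_I_re] using h3

/-- The product of the cosines is at most `exp (-11 / 25) ≤ 25 / 36`, and `2 / 3 + 25 / 108 < 9 / 10
≤ exp (-1 / 10)`. -/
theorem sum_exp_neg_abs_inner_signVec_le {d : ℕ} {u : EuclideanSpace ℝ (Fin d)} (hu : ‖u‖ = 1) :
    ∑ e : Fin d → Bool, Real.exp (-|inner ℝ (signVec e) u|) ≤ 2 ^ d * Real.exp (-(1 / 10)) := by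
  have h1 : ∏ j, Real.cos (u j) ≤ Real.exp (-(11 / 25)) := by
    have h2 : Real.exp (-(11 / 25)) = ∏ j, Real.exp (-(11 / 25) * u j ^ 2) := by
      rw [← Real.exp_sum, ← Finset.mul_sum]
      have := EuclideanSpace.norm_sq_eq u
      simp only [hu, Real.norm_eq_abs, sq_abs] at this
      rw [← this]; norm_num
    rw [h2]
    have hj : ∀ j, |u j| ≤ 1 := fun j => by
      rw [← hu, ← Real.norm_eq_abs]; exact PiLp.norm_apply_le u j
    refine Finset.prod_le_prod (fun j _ => ?_) fun j _ => cos_le_exp_neg_sq (hj j)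
    exact Real.cos_nonneg_of_neg_pi_div_two_le_of_le
      (by linarith [(abs_le.1 (hj j)).1, Real.pi_gt_three])
      (by linarith [(abs_le.1 (hj j)).2, Real.pi_gt_three])
  have h3 : Real.exp (-(11 / 25)) ≤ 25 / 36 := by
    rw [Real.exp_neg, show (25 / 36 : ℝ) = (36 / 25)⁻¹ by norm_num]
    exact inv_anti₀ (by norm_num) (by linarith [Real.add_one_le_exp (11 / 25 : ℝ)])
  have h4 := Real.add_one_le_exp (-(1 / 10) : ℝ)
  calc _ ≤ ∑ e : Fin d → Bool, (2 / 3 + Real.cos (inner ℝ (signVec e) u) / 3) :=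
        Finset.sum_le_sum fun e _ => (exp_neg_abs_le _).trans (by linarith)
    _ = 2 ^ d * (2 / 3 + (∏ j, Real.cos (u j)) / 3) := by
        rw [Finset.sum_add_distrib, ← Finset.sum_div, ← Finset.sum_div, sum_cos_inner_signVec,
          Finset.sum_const]
        simp
        ring
    _ ≤ _ := mul_le_mul_of_nonneg_left (by linarith) (by positivity)

/-- Independence of the rows gives the moment `exp (-N / 10)`; the threshold `N / 20` spends half of
this exponent. -/
theorem card_sum_abs_inner_le {d N : ℕ} {z : EuclideanSpace ℝ (Fin d)} (hz : z ≠ 0) :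
    ((Finset.univ.filter fun ω : Fin N → Fin d → Bool =>
      ∑ i, |inner ℝ (signVec (ω i)) z| ≤ N / 20 * ‖z‖).card : ℝ) ≤
      (2 ^ d) ^ N * Real.exp (-(N / 20)) := by
  have hz' : 0 < ‖z‖ := norm_pos_iff.2 hz
  set u : EuclideanSpace ℝ (Fin d) := ‖z‖⁻¹ • z with hu
  have hu1 : ‖u‖ = 1 := by
    rw [hu, norm_smul, norm_inv, norm_norm, inv_mul_cancel₀ hz'.ne']
  have h1 : ∑ ω : Fin N → Fin d → Bool, Real.exp (-∑ i, |inner ℝ (signVec (ω i)) u|) ≤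
      (2 ^ d * Real.exp (-(1 / 10))) ^ N := by
    refine le_trans (le_of_eq ?_) (pow_le_pow_left₀ (Finset.sum_nonneg fun _ _ => Real.exp_nonneg _)
      (sum_exp_neg_abs_inner_signVec_le hu1) N)
    rw [Fintype.sum_pow]
    exact Finset.sum_congr rfl fun ω _ => by rw [← Real.exp_sum, Finset.sum_neg_distrib]
  have h2 := card_filter_le_of_sum_exp _ (-(N / 20 : ℝ)) _ h1
  rw [mul_pow, mul_assoc, ← Real.exp_nat_mul, ← Real.exp_add] at h2
  have e : (N : ℝ) * -(1 / 10) + - -((N : ℝ) / 20) = -(N / 20) := by ring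
  rw [e] at h2
  refine le_trans (Nat.cast_le.2 (Finset.card_le_card fun ω hω => ?_)) h2
  simp only [Finset.mem_filter, Finset.mem_univ, true_and] at hω ⊢
  have h3 : ∀ i, |inner ℝ (signVec (ω i)) u| = ‖z‖⁻¹ * |inner ℝ (signVec (ω i)) z| := fun i => by
    rw [hu, inner_smul_right, abs_mul, abs_of_pos (inv_pos.2 hz')]
  simp_rw [h3]
  rw [← Finset.mul_sum, neg_le_neg_iff, inv_mul_le_iff₀ hz']
  linarith

/-! ### Integer points as a net -/

/-- An integer vector as a point of Euclidean space. -/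
noncomputable def latticePt {d : ℕ} (z : Fin d → ℤ) : EuclideanSpace ℝ (Fin d) :=
  WithLp.toLp 2 fun j => (z j : ℝ)

/-- The integer vectors of `ℓ₁`-norm at most `M`. -/
noncomputable def latticeBall (d M : ℕ) : Finset (Fin d → ℤ) :=
  (Fintype.piFinset fun _ => Finset.Icc (-(M : ℤ)) M).filter fun z => ∑ j, (z j).natAbs ≤ M

theorem mem_latticeBall {d M : ℕ} {z : Fin d → ℤ} :
    z ∈ latticeBall d M ↔ ∑ j, (z j).natAbs ≤ M := by
  simp only [latticeBall, Finset.mem_filter, Fintype.mem_piFinset, Finset.mem_Icc,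
    and_iff_right_iff_imp]
  intro h j
  have := (Finset.single_le_sum (f := fun j => (z j).natAbs) (fun _ _ => Nat.zero_le _)
    (Finset.mem_univ j)).trans h
  omega

theorem sum_half_pow_natAbs_le (M : ℕ) :
    ∑ t ∈ Finset.Icc (-(M : ℤ)) M, (1 / 2 : ℝ) ^ t.natAbs ≤ 4 := by
  have hsub : Finset.Icc (-(M : ℤ)) M ⊆
      (Finset.range (M + 1)).image (fun n : ℕ => (n : ℤ)) ∪
        (Finset.range (M + 1)).image (fun n : ℕ => -(n : ℤ)) := by
    intro t ht
    simp only [Finset.mem_Icc, Finset.mem_union, Finset.mem_image, Finset.mem_range] at ht ⊢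
    rcases le_total 0 t with h | h
    · exact Or.inl ⟨t.natAbs, by omega, by omega⟩
    · exact Or.inr ⟨t.natAbs, by omega, by omega⟩
  have hgeom : ∑ n ∈ Finset.range (M + 1), (1 / 2 : ℝ) ^ n ≤ 2 := by
    rw [geom_sum_eq (by norm_num)]
    have : (0 : ℝ) ≤ (1 / 2) ^ (M + 1) := by positivity
    rw [div_le_iff_of_neg (by norm_num)]
    linarith
  have hpos : ∀ t : ℤ, (0 : ℝ) ≤ (1 / 2 : ℝ) ^ t.natAbs := fun t => by positivity
  refine (Finset.sum_le_sum_of_subset_of_nonneg hsub fun t _ _ => hpos t).trans ?_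
  have h1 := Finset.sum_union_inter (s₁ := (Finset.range (M + 1)).image (fun n : ℕ => (n : ℤ)))
    (s₂ := (Finset.range (M + 1)).image (fun n : ℕ => -(n : ℤ)))
    (f := fun t : ℤ => (1 / 2 : ℝ) ^ t.natAbs)
  rw [Finset.sum_image (by intro a _ b _ h; simpa using h),
    Finset.sum_image (by intro a _ b _ h; simpa using h)] at h1
  simp only [Int.natAbs_natCast, Int.natAbs_neg] at h1
  have h2 : (0 : ℝ) ≤ ∑ t ∈ (Finset.range (M + 1)).image (fun n : ℕ => (n : ℤ)) ∩
    (Finset.range (M + 1)).image (fun n : ℕ => -(n : ℤ)), (1 / 2 : ℝ) ^ t.natAbs :=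
    Finset.sum_nonneg fun t _ => hpos t
  linarith

/-- Give `z` the weight `∏ 2 ^ (-|z j|)`: each point of the ball weighs at least `2 ^ (-M)`, and the
whole box at most `4 ^ d`. -/
theorem card_latticeBall_le (d M : ℕ) : ((latticeBall d M).card : ℝ) ≤ 4 ^ d * 2 ^ M := by
  have h1 : ((latticeBall d M).card : ℝ) * (1 / 2) ^ M ≤ 4 ^ d := by
    rw [← nsmul_eq_mul]
    calc _ ≤ ∑ z ∈ latticeBall d M, ∏ j, (1 / 2 : ℝ) ^ (z j).natAbs := by
          refine Finset.card_nsmul_le_sum _ _ _ fun z hz => ?_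
          rw [Finset.prod_pow_eq_pow_sum]
          exact pow_le_pow_of_le_one (by norm_num) (by norm_num) (mem_latticeBall.1 hz)
      _ ≤ ∑ z ∈ Fintype.piFinset fun _ : Fin d => Finset.Icc (-(M : ℤ)) M,
            ∏ j, (1 / 2 : ℝ) ^ (z j).natAbs :=
          Finset.sum_le_sum_of_subset_of_nonneg (Finset.filter_subset _ _)
            fun z _ _ => Finset.prod_nonneg fun j _ => by positivity
      _ = (∑ t ∈ Finset.Icc (-(M : ℤ)) M, (1 / 2 : ℝ) ^ t.natAbs) ^ d :=
          (Finset.sum_pow' _ (fun t : ℤ => (1 / 2 : ℝ) ^ t.natAbs) d).symm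
      _ ≤ 4 ^ d := pow_le_pow_left₀ (Finset.sum_nonneg fun t _ => by positivity)
          (sum_half_pow_natAbs_le M) d
  rw [one_div, inv_pow, ← div_eq_mul_inv, div_le_iff₀ (by positivity)] at h1
  exact h1

open Classical in
-- There are at most `4 ^ d * 2 ^ (62 d) = 2 ^ (64 d)` points, and each fails with probability at
-- most `exp (-N / 20) ≤ exp (-100 d)`.
theorem card_not_lattice_lower_le {d N : ℕ} (hd : 1 ≤ d) (hN : 2000 * d ≤ N) :
    ((Finset.univ.filter fun ω : Fin N → Fin d → Bool =>
      ¬ ∀ z ∈ latticeBall d (62 * d), latticePt z ≠ 0 →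
        N / 20 * ‖latticePt z‖ < ∑ i, |inner ℝ (signVec (ω i)) (latticePt z)|).card : ℝ) ≤
      (2 ^ d) ^ N * (1 / 6) := by
  let T : (Fin d → ℤ) → Finset (Fin N → Fin d → Bool) := fun z =>
    Finset.univ.filter fun ω => latticePt z ≠ 0 ∧
      ∑ i, |inner ℝ (signVec (ω i)) (latticePt z)| ≤ N / 20 * ‖latticePt z‖
  have hsub : (Finset.univ.filter fun ω : Fin N → Fin d → Bool =>
      ¬ ∀ z ∈ latticeBall d (62 * d), latticePt z ≠ 0 →
        N / 20 * ‖latticePt z‖ < ∑ i, |inner ℝ (signVec (ω i)) (latticePt z)|) ⊆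
      (latticeBall d (62 * d)).biUnion T := by
    intro ω hω
    simp only [Finset.mem_filter, Finset.mem_univ, true_and, Finset.mem_biUnion, T] at hω ⊢
    push Not at hω
    exact hω
  have hT : ∀ z, ((T z).card : ℝ) ≤ (2 ^ d) ^ N * Real.exp (-(N / 20)) := by
    intro z
    by_cases hz : latticePt z = 0
    · have : T z = ∅ := by
        ext ω; simp [T, hz]
      rw [this]
      simp only [Finset.card_empty, Nat.cast_zero]
      positivity
    · refine le_trans (Nat.cast_le.2 (Finset.card_le_card fun ω hω => ?_))
        (card_sum_abs_inner_le hz)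
      simp only [Finset.mem_filter, Finset.mem_univ, true_and, T] at hω ⊢
      exact hω.2
  have h1 := (Nat.cast_le (α := ℝ)).2 ((Finset.card_le_card hsub).trans Finset.card_biUnion_le)
  refine h1.trans ?_
  push_cast
  refine (Finset.sum_le_sum fun σ _ => hT σ).trans ?_
  rw [Finset.sum_const, nsmul_eq_mul, mul_left_comm]
  refine mul_le_mul_of_nonneg_left ?_ (by positivity)
  refine (mul_le_mul_of_nonneg_right (card_latticeBall_le d (62 * d)) (Real.exp_nonneg _)).trans ?_
  have h3 : (4 : ℝ) ^ d * 2 ^ (62 * d) ≤ Real.exp (64 * d) := by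
    have : (4 : ℝ) ^ d * 2 ^ (62 * d) = 2 ^ (64 * d) := by
      rw [show (4 : ℝ) = 2 ^ 2 by norm_num, ← pow_mul, ← pow_add]; congr 1; ring
    rw [this, show (64 : ℝ) * d = ((64 * d : ℕ) : ℝ) * 1 by push_cast; ring, Real.exp_nat_mul]
    exact pow_le_pow_left₀ (by norm_num) (by linarith [Real.add_one_le_exp (1 : ℝ)]) _
  refine (mul_le_mul_of_nonneg_right h3 (Real.exp_nonneg _)).trans ?_
  rw [← Real.exp_add]
  have hNr : 2000 * (d : ℝ) ≤ N := by exact_mod_cast hN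
  have hdr : (1 : ℝ) ≤ d := by exact_mod_cast hd
  have h4 : Real.exp (64 * (d : ℝ) + -(N / 20)) ≤ Real.exp (-5) :=
    Real.exp_le_exp.2 (by linarith)
  refine h4.trans ?_
  rw [Real.exp_neg, one_div]
  exact inv_anti₀ (by norm_num) (by linarith [Real.add_one_le_exp (5 : ℝ)])

/-! ### Constant distortion for most sign matrices -/

/-- The vectors `b₀, …, b_{N-1}` embed Euclidean space into `ℓ₁` with constant distortion. -/
def IsKashin {d : ℕ} (N : ℕ) (b : ℕ → EuclideanSpace ℝ (Fin d)) : Prop :=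
  ∀ u, N / 40 * ‖u‖ ≤ ∑ i ∈ Finset.range N, |inner ℝ (b i) u| ∧
    ∑ i ∈ Finset.range N, |inner ℝ (b i) u| ≤ 3 * N * ‖u‖

/-- Scaled to length `61 √d`, a vector is within `√d / 2` of an integer point. In units of `N √d`,
the lattice bound gives `121 / 40`, the upper bound charges `3 / 2` for the rounding, and exactly
the required `61 / 40` remains. -/
theorem isKashin_of_lattice {d N : ℕ} (hd : 1 ≤ d) (b : ℕ → EuclideanSpace ℝ (Fin d))
    (hup : ∀ u, ∑ i ∈ Finset.range N, |inner ℝ (b i) u| ≤ 3 * N * ‖u‖)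
    (hlow : ∀ z ∈ latticeBall d (62 * d), latticePt z ≠ 0 →
        N / 20 * ‖latticePt z‖ ≤ ∑ i ∈ Finset.range N, |inner ℝ (b i) (latticePt z)|) :
    IsKashin N b := by
  refine fun u => ⟨?_, hup u⟩
  by_cases hu : u = 0
  · simp [hu]
  have hu' : 0 < ‖u‖ := norm_pos_iff.2 hu
  have hd' : (1 : ℝ) ≤ d := by exact_mod_cast hd
  have hsd : 0 < Real.sqrt d := Real.sqrt_pos.2 (by linarith)
  set t : ℝ := 61 * Real.sqrt d / ‖u‖ with ht
  have ht0 : 0 < t := by positivity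
  have htu : ‖t • u‖ = 61 * Real.sqrt d := by
    rw [norm_smul, Real.norm_of_nonneg ht0.le, ht]; field_simp
  set z : Fin d → ℤ := fun j => round (t * u j) with hz
  have hdist : ‖latticePt z - t • u‖ ≤ Real.sqrt d / 2 := by
    refine abs_le_of_sq_le_sq' ?_ (by positivity) |>.2
    rw [EuclideanSpace.norm_sq_eq, div_pow, Real.sq_sqrt (by positivity)]
    calc _ ≤ ∑ j : Fin d, (1 / 2 : ℝ) ^ 2 := by
          refine Finset.sum_le_sum fun j _ => pow_le_pow_left₀ (norm_nonneg _) ?_ 2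
          have := abs_sub_round (t * u j)
          rw [abs_sub_comm] at this
          simpa [latticePt, hz] using this
      _ = _ := by simp; ring
  have hzlow : 121 / 2 * Real.sqrt d ≤ ‖latticePt z‖ := by
    have := norm_sub_norm_le (t • u) (latticePt z)
    rw [norm_sub_rev, htu] at this
    linarith
  have hzup : ‖latticePt z‖ ≤ 62 * Real.sqrt d := by
    have := norm_sub_norm_le (latticePt z) (t • u)
    rw [htu] at this
    linarith
  have hz0 : latticePt z ≠ 0 := norm_pos_iff.1 (by nlinarith)
  -- Cauchy–Schwarz: Euclidean norm at most `62 √d` gives `ℓ₁`-norm at most `62 d`.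
  have hmem : z ∈ latticeBall d (62 * d) := by
    rw [mem_latticeBall]
    have h1 : ((∑ j, (z j).natAbs : ℕ) : ℝ) = ∑ j, |(z j : ℝ)| := by
      push_cast
      exact Finset.sum_congr rfl fun j _ => by rw [Nat.cast_natAbs, Int.cast_abs]
    have h2 : (∑ j, |(z j : ℝ)|) ^ 2 ≤ (62 * d) ^ 2 := by
      refine (sq_sum_le_card_mul_sum_sq).trans ?_
      have h3 : ∑ j, |(z j : ℝ)| ^ 2 = ‖latticePt z‖ ^ 2 := by
        rw [EuclideanSpace.norm_sq_eq]
        rfl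
      rw [h3]
      have h4 : ‖latticePt z‖ ^ 2 ≤ (62 * Real.sqrt d) ^ 2 :=
        pow_le_pow_left₀ (norm_nonneg _) hzup 2
      rw [mul_pow, Real.sq_sqrt (by positivity)] at h4
      simp only [Finset.card_univ, Fintype.card_fin]
      nlinarith
    have h5 := (abs_le_of_sq_le_sq' h2 (by positivity)).2
    rw [← h1] at h5
    exact_mod_cast h5
  have h1 := hlow z hmem hz0
  have h2 := hup (latticePt z - t • u)
  have h3 : ∑ i ∈ Finset.range N, |inner ℝ (b i) (latticePt z)| ≤
      t * (∑ i ∈ Finset.range N, |inner ℝ (b i) u|) +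
      ∑ i ∈ Finset.range N, |inner ℝ (b i) (latticePt z - t • u)| := by
    rw [Finset.mul_sum, ← Finset.sum_add_distrib]
    refine Finset.sum_le_sum fun i _ => ?_
    have : inner ℝ (b i) (latticePt z) =
        t * inner ℝ (b i) u + inner ℝ (b i) (latticePt z - t • u) := by
      rw [inner_sub_right, inner_smul_right]; ring
    rw [this]
    refine (abs_add_le _ _).trans ?_
    rw [abs_mul, abs_of_pos ht0]
  have hN : (0 : ℝ) ≤ N := N.cast_nonneg
  have h4 : t * (N / 40 * ‖u‖) = N / 40 * (61 * Real.sqrt d) := by rw [ht]; field_simp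
  refine le_of_mul_le_mul_left ?_ ht0
  rw [h4]
  have h5 : N / 20 * (121 / 2 * Real.sqrt d) ≤ N / 20 * ‖latticePt z‖ :=
    mul_le_mul_of_nonneg_left hzlow (by positivity)
  have h6 : 3 * N * ‖latticePt z - t • u‖ ≤ 3 * N * (Real.sqrt d / 2) :=
    mul_le_mul_of_nonneg_left hdist (by positivity)
  have h7 : 0 ≤ N * Real.sqrt d := by positivity
  linarith

open Classical in
theorem card_isKashin_ge {d N : ℕ} (hd : 1 ≤ d) (hN : 2000 * d ≤ N) :
    2 / 3 * (2 ^ d : ℝ) ^ N ≤ ((Finset.univ.filter fun ω : Fin N → Fin d → Bool =>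
      IsKashin N fun i => if h : i < N then signVec (ω ⟨i, h⟩) else 0).card : ℝ) := by
  have hsum : ∀ (ω : Fin N → Fin d → Bool) (u : EuclideanSpace ℝ (Fin d)),
      ∑ i ∈ Finset.range N, |inner ℝ (if h : i < N then signVec (ω ⟨i, h⟩) else 0) u| =
        ∑ i, |inner ℝ (signVec (ω i)) u| := fun ω u => by
    rw [Finset.sum_range]
    exact Finset.sum_congr rfl fun i _ => by simp
  set G := Finset.univ.filter fun ω : Fin N → Fin d → Bool =>
      IsKashin N fun i => if h : i < N then signVec (ω ⟨i, h⟩) else 0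
  have hcompl : Gᶜ ⊆ (Finset.univ.filter fun ω : Fin N → Fin d → Bool =>
      ¬ ∀ u : EuclideanSpace ℝ (Fin d), ∑ i, |inner ℝ (signVec (ω i)) u| ≤ 3 * N * ‖u‖) ∪
      (Finset.univ.filter fun ω : Fin N → Fin d → Bool =>
      ¬ ∀ z ∈ latticeBall d (62 * d), latticePt z ≠ 0 →
        N / 20 * ‖latticePt z‖ < ∑ i, |inner ℝ (signVec (ω i)) (latticePt z)|) := by
    intro ω hω
    by_contra hcon
    simp only [Finset.mem_union, Finset.mem_filter, Finset.mem_univ, true_and, not_or,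
      not_not] at hcon
    refine Finset.mem_compl.1 hω (Finset.mem_filter.2 ⟨Finset.mem_univ _, ?_⟩)
    refine isKashin_of_lattice hd _ (fun u => ?_) fun z hz hz0 => ?_
    · rw [hsum]; exact hcon.1 u
    · rw [hsum]; exact (hcon.2 z hz hz0).le
  have h1 := (Nat.cast_le (α := ℝ)).2 ((Finset.card_le_card hcompl).trans (Finset.card_union_le _ _))
  push_cast at h1
  have h2 := card_not_upper_le hd hN
  have h3 := card_not_lattice_lower_le hd hN
  have h4 : (G.card : ℝ) + (Gᶜ.card : ℝ) = (2 ^ d) ^ N := by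
    have := Finset.card_add_card_compl G
    simp only [Fintype.card_pi, Fintype.card_bool, Finset.prod_const, Finset.card_univ,
      Fintype.card_fin] at this
    exact_mod_cast this
  linarith

/-! ### Reading the matrix from the random bits -/

/-- The vector in row `i` of the sign matrix whose entries are stored as bits in `s`. -/
noncomputable def bitRow (d : ℕ) (s : ℕ → ℝ) (i : ℕ) : EuclideanSpace ℝ (Fin d) :=
  WithLp.toLp 2 fun j => 2 * s (i * d + j) - 1

/-- A bit string as the content of an array. -/
noncomputable def bitCells {l : ℕ} (seed : Fin l → Bool) (i : ℕ) : ℝ :=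
  if h : i < l then (if seed ⟨i, h⟩ then 1 else 0) else 0

theorem isKashin_congr {d N : ℕ} {b b' : ℕ → EuclideanSpace ℝ (Fin d)}
    (h : ∀ i < N, b i = b' i) (hb : IsKashin N b) : IsKashin N b' := by
  intro u
  have : ∑ i ∈ Finset.range N, |inner ℝ (b' i) u| = ∑ i ∈ Finset.range N, |inner ℝ (b i) u| :=
    Finset.sum_congr rfl fun i hi => by rw [h i (Finset.mem_range.1 hi)]
  rw [this]
  exact hb u

/-- The matrix occupies the first `N d` bits in row-major order. The remaining bits are free, so the
good strings form a product set of the same density. -/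
theorem exists_good_seeds {d N l : ℕ} (hd : 1 ≤ d) (hN : 2000 * d ≤ N) (hl : N * d ≤ l) :
    ∃ good : Finset (Fin l → Bool), (2 / 3 : ℝ) * 2 ^ l ≤ (good.card : ℝ) ∧
      ∀ seed ∈ good, IsKashin N (bitRow d (bitCells seed)) := by
  classical
  obtain ⟨m, rfl⟩ := Nat.exists_eq_add_of_le hl
  let Φ : (Fin N → Fin d → Bool) × (Fin m → Bool) ≃ (Fin (N * d + m) → Bool) :=
    (Equiv.prodCongr ((Equiv.curry (Fin N) (Fin d) Bool).symm.trans
      (Equiv.arrowCongr finProdFinEquiv (Equiv.refl Bool))) (Equiv.refl _)).trans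
      (Fin.appendEquiv (N * d) m)
  have hΦ : ∀ ω τ (i : Fin N) (j : Fin d) (h : (i : ℕ) * d + j < N * d + m),
      Φ (ω, τ) ⟨i * d + j, h⟩ = ω i j := by
    intro ω τ i j h
    have e : (⟨i * d + j, h⟩ : Fin (N * d + m)) = Fin.castAdd m (finProdFinEquiv (i, j)) := by
      ext; simp [mul_comm, add_comm]
    rw [e]
    simp [Φ, Fin.appendEquiv]
  set G := Finset.univ.filter fun ω : Fin N → Fin d → Bool =>
      IsKashin N fun i => if h : i < N then signVec (ω ⟨i, h⟩) else 0 with hG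
  refine ⟨(G ×ˢ Finset.univ).map Φ.toEmbedding, ?_, ?_⟩
  · rw [Finset.card_map, Finset.card_product]
    have h := card_isKashin_ge hd hN
    rw [← hG, ← pow_mul, mul_comm d N] at h
    push_cast
    rw [pow_add, ← mul_assoc]
    exact mul_le_mul h (by simp) (by positivity) (by positivity)
  · intro seed hs
    obtain ⟨⟨ω, τ⟩, hp, rfl⟩ := Finset.mem_map.1 hs
    refine isKashin_congr (fun i hi => ?_)
      (Finset.mem_filter.1 (Finset.mem_product.1 hp).1).2
    simp only [hi, dif_pos]
    ext j
    have hlt : i * d + (j : ℕ) < N * d + m := by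
      have := Nat.mul_le_mul_right d (Nat.succ_le_of_lt hi)
      rw [Nat.succ_mul] at this
      omega
    simp only [signVec, bitRow, bitCells, hlt, dif_pos]
    rw [Equiv.coe_toEmbedding, hΦ ω τ ⟨i, hi⟩ j hlt]
    split_ifs <;> norm_num

/-! ### Expansions with small coefficients -/

/-- Duality: pair the combination with itself and apply the upper half of `IsKashin` to it. -/
theorem IsKashin.norm_sum_smul_le {d N : ℕ} {b : ℕ → EuclideanSpace ℝ (Fin d)}
    (hb : IsKashin N b) {e : ℕ → ℝ} {η : ℝ} (he : ∀ i < N, |e i| ≤ η) (hη : 0 ≤ η) :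
    ‖∑ i ∈ Finset.range N, e i • b i‖ ≤ 3 * N * η := by
  set v := ∑ i ∈ Finset.range N, e i • b i with hv
  rcases eq_or_ne v 0 with h0 | h0
  · rw [h0, norm_zero]; positivity
  have hpos : 0 < ‖v‖ := norm_pos_iff.2 h0
  refine le_of_mul_le_mul_right ?_ hpos
  calc ‖v‖ * ‖v‖ = inner ℝ v v := (real_inner_self_eq_norm_mul_norm v).symm
    _ = ∑ i ∈ Finset.range N, e i * inner ℝ (b i) v := by
        conv_lhs => rw [hv]
        rw [← hv, sum_inner]
        exact Finset.sum_congr rfl fun i _ => real_inner_smul_left _ _ _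
    _ ≤ ∑ i ∈ Finset.range N, η * |inner ℝ (b i) v| := Finset.sum_le_sum fun i hi => by
        refine (le_abs_self _).trans ?_
        rw [abs_mul]
        exact mul_le_mul_of_nonneg_right (he i (Finset.mem_range.1 hi)) (abs_nonneg _)
    _ ≤ η * (3 * N * ‖v‖) := by
        rw [← Finset.mul_sum]; exact mul_le_mul_of_nonneg_left (hb v).2 hη
    _ = 3 * N * η * ‖v‖ := by ring

/-- The factor by which one step of the expansion shrinks the residual. -/
noncomputable def shrink : ℝ := 1 - 1 / 120000

theorem shrink_pos : 0 < shrink := by unfold shrink; norm_num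

theorem shrink_lt_one : shrink < 1 := by unfold shrink; norm_num

/-- The residual after `k` steps of the expansion of `x` in the vectors `b₀, …, b_{N-1}`. -/
noncomputable def resid {d : ℕ} (N : ℕ) (b : ℕ → EuclideanSpace ℝ (Fin d)) (R : ℝ)
    (x : EuclideanSpace ℝ (Fin d)) : ℕ → EuclideanSpace ℝ (Fin d)
  | 0 => x
  | k + 1 => resid N b R x k - (R * shrink ^ k / (720 * N)) •
      ∑ i ∈ Finset.range N, sgn (inner ℝ (b i) (resid N b R x k)) • b i

/-- The coefficient of `720 * N • b i` after `k` steps of the expansion of `x`. -/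
noncomputable def coef {d : ℕ} (N : ℕ) (b : ℕ → EuclideanSpace ℝ (Fin d)) (R : ℝ)
    (x : EuclideanSpace ℝ (Fin d)) (i k : ℕ) : ℝ :=
  ∑ j ∈ Finset.range k, R * shrink ^ j * sgn (inner ℝ (b i) (resid N b R x j))

/-- The step size uses the known bound `ρ`, so no norm has to be computed. The inner product gains
`ρ ‖r‖ / 14400` and the square costs `ρ² / 57600`. The resulting bound is convex in `‖r‖`, and at
its worst point `‖r‖ = ρ` it equals `ρ² (1 - 1 / 19200)`, below `(ρ * shrink) ^ 2`. -/
theorem IsKashin.norm_step_le {d N : ℕ} (hN : 0 < N) {b : ℕ → EuclideanSpace ℝ (Fin d)}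
    (hb : IsKashin N b) {r : EuclideanSpace ℝ (Fin d)} {ρ : ℝ} (hr : ‖r‖ ≤ ρ) :
    ‖r - (ρ / (720 * N)) • ∑ i ∈ Finset.range N, sgn (inner ℝ (b i) r) • b i‖ ≤ ρ * shrink := by
  have hN' : (0 : ℝ) < N := by exact_mod_cast hN
  have h0 := norm_nonneg r
  have hρ : 0 ≤ ρ := h0.trans hr
  set S := ∑ i ∈ Finset.range N, sgn (inner ℝ (b i) r) • b i with hS
  have hS1 : ‖S‖ ≤ 3 * N := by
    have := hb.norm_sum_smul_le (e := fun i => sgn (inner ℝ (b i) r))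
      (fun i _ => (abs_sgn _).le) zero_le_one
    simpa using this
  have hS2 : N / 40 * ‖r‖ ≤ inner ℝ r S := by
    refine (hb r).1.trans (le_of_eq ?_)
    rw [hS, inner_sum]
    exact Finset.sum_congr rfl fun i _ => by
      rw [inner_smul_right, real_inner_comm, sgn_mul_self]
  refine abs_le_of_sq_le_sq' ?_ (mul_nonneg hρ shrink_pos.le) |>.2
  rw [norm_sub_sq_real, inner_smul_right, norm_smul, mul_pow, Real.norm_eq_abs, sq_abs]
  have h1 : ρ / (720 * N) * (N / 40 * ‖r‖) ≤ ρ / (720 * N) * inner ℝ r S :=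
    mul_le_mul_of_nonneg_left hS2 (by positivity)
  have h2 : (ρ / (720 * N)) ^ 2 * ‖S‖ ^ 2 ≤ (ρ / (720 * N)) ^ 2 * (3 * N) ^ 2 :=
    mul_le_mul_of_nonneg_left (pow_le_pow_left₀ (norm_nonneg _) hS1 2) (by positivity)
  have h3 : ρ / (720 * N) * (N / 40 * ‖r‖) = ρ * ‖r‖ / 28800 := by field_simp; ring
  have h4 : (ρ / (720 * N)) ^ 2 * (3 * N) ^ 2 = ρ ^ 2 / 57600 := by field_simp; ring
  rw [h3] at h1
  rw [h4] at h2
  unfold shrink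
  nlinarith [mul_nonneg h0 (sub_nonneg.2 hr), mul_nonneg hρ (sub_nonneg.2 hr), sq_nonneg ρ]

theorem IsKashin.norm_resid_le {d N : ℕ} (hN : 0 < N) {b : ℕ → EuclideanSpace ℝ (Fin d)}
    (hb : IsKashin N b) {R : ℝ} {x : EuclideanSpace ℝ (Fin d)} (hx : ‖x‖ ≤ R) (k : ℕ) :
    ‖resid N b R x k‖ ≤ R * shrink ^ k := by
  induction k with
  | zero => simpa [resid] using hx
  | succ k ih =>
    rw [resid, pow_succ, ← mul_assoc]
    exact hb.norm_step_le hN ih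

theorem resid_add_sum_coef {d N : ℕ} (b : ℕ → EuclideanSpace ℝ (Fin d)) (R : ℝ)
    (x : EuclideanSpace ℝ (Fin d)) (k : ℕ) :
    resid N b R x k + (1 / (720 * N : ℝ)) • ∑ i ∈ Finset.range N, coef N b R x i k • b i = x := by
  induction k with
  | zero => simp [resid, coef]
  | succ k ih =>
    have h : ∑ i ∈ Finset.range N, coef N b R x i (k + 1) • b i =
        ∑ i ∈ Finset.range N, coef N b R x i k • b i + (R * shrink ^ k) •
          ∑ i ∈ Finset.range N, sgn (inner ℝ (b i) (resid N b R x k)) • b i := by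
      rw [Finset.smul_sum, ← Finset.sum_add_distrib]
      exact Finset.sum_congr rfl fun i _ => by
        rw [coef, Finset.sum_range_succ, add_smul, mul_smul]; rfl
    have e : 1 / (720 * (N : ℝ)) * (R * shrink ^ k) = R * shrink ^ k / (720 * N) := by ring
    rw [h, resid, smul_add, smul_smul, e]
    refine Eq.trans ?_ ih
    abel

/-- The step sizes form a geometric series of sum at most `R / (1 - shrink)`, whatever the number of
steps. -/
theorem abs_coef_le {d N : ℕ} (b : ℕ → EuclideanSpace ℝ (Fin d)) {R : ℝ} (hR : 0 ≤ R)
    (x : EuclideanSpace ℝ (Fin d)) (i k : ℕ) : |coef N b R x i k| ≤ 120000 * R := by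
  have h1 : |coef N b R x i k| ≤ ∑ j ∈ Finset.range k, R * shrink ^ j := by
    refine (Finset.abs_sum_le_sum_abs _ _).trans (Finset.sum_le_sum fun j _ => ?_)
    rw [abs_mul, abs_sgn, mul_one, abs_of_nonneg (mul_nonneg hR (pow_nonneg shrink_pos.le _))]
  refine h1.trans ?_
  rw [← Finset.mul_sum, geom_sum_eq shrink_lt_one.ne, mul_comm 120000 R]
  refine mul_le_mul_of_nonneg_left ?_ hR
  rw [div_le_iff_of_neg (by linarith [shrink_lt_one])]
  have := pow_nonneg shrink_pos.le k
  unfold shrink at *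
  linarith

/-! ### Measurability of the coefficients, on which the guarantee of the oracle depends -/

theorem measurable_sgn : Measurable sgn :=
  Measurable.ite measurableSet_Iio measurable_const measurable_const

theorem measurable_resid {d N : ℕ} (b : ℕ → EuclideanSpace ℝ (Fin d)) (R : ℝ) (k : ℕ) :
    Measurable fun x => resid N b R x k := by
  induction k with
  | zero => exact measurable_id
  | succ k ih =>
    refine ih.sub (Measurable.fun_const_smul ?_ _)
    refine Finset.measurable_fun_sum _ fun i _ => ?_
    exact (measurable_sgn.comp (measurable_const.inner ih)).smul_const _

theorem measurable_coef {d N : ℕ} (b : ℕ → EuclideanSpace ℝ (Fin d)) (R : ℝ) (i k : ℕ) :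
    Measurable fun x => coef N b R x i k :=
  Finset.measurable_fun_sum _ fun j _ => measurable_const.mul
    (measurable_sgn.comp (measurable_const.inner (measurable_resid b R j)))

/-! ### One step of the perceptron -/

section step

variable {d : ℕ} {R : ℝ}

/-- The label of an example as a real number. -/
noncomputable def label (z : Example d R) : ℝ := ((z.2 : ℤ) : ℝ)

theorem abs_label (z : Example d R) : |label z| = 1 := by
  rcases Int.units_eq_one_or z.2 with h | h <;> simp [label, h]

theorem margin_eq (w : EuclideanSpace ℝ (Fin d)) (z : Example d R) :
    margin w z = label z * inner ℝ w (z.1 : EuclideanSpace ℝ (Fin d)) := rfl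

theorem norm_example_le (z : Example d R) : ‖(z.1 : EuclideanSpace ℝ (Fin d))‖ ≤ R :=
  mem_closedBall_zero_iff.1 z.1.2

theorem abs_margin_le (w : EuclideanSpace ℝ (Fin d)) (z : Example d R) :
    |margin w z| ≤ ‖w‖ * R := by
  rw [margin_eq, abs_mul, abs_label, one_mul]
  exact (abs_real_inner_le_norm _ _).trans
    (mul_le_mul_of_nonneg_left (norm_example_le z) (norm_nonneg _))

theorem measurable_label : Measurable (label : Example d R → ℝ) := by
  have h1 : Measurable (fun u : ℤˣ => (u : ℤ)) := comap_measurable Units.val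
  have h2 : Measurable (fun n : ℤ => (n : ℝ)) := measurable_from_top
  exact h2.comp (h1.comp measurable_snd)

theorem measurable_margin (w : EuclideanSpace ℝ (Fin d)) :
    Measurable (margin w : Example d R → ℝ) :=
  measurable_label.mul (measurable_const.inner (measurable_subtype_coe.comp measurable_fst))

theorem measurableSet_margin_lt (w : EuclideanSpace ℝ (Fin d)) (c : ℝ) :
    MeasurableSet {z : Example d R | margin w z < c} :=
  measurableSet_lt (measurable_margin w) measurable_const

open Classical in
/-- The query for the probability of a margin below `γ / 2`. -/
noncomputable def errQuery (γ : ℝ) (w : EuclideanSpace ℝ (Fin d)) (z : Example d R) : ℝ :=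
  if margin w z < γ / 2 then 1 else 0

open Classical in
/-- The query for the `i`-th coefficient of the mean of the examples of margin below `γ / 2`. -/
noncomputable def coefQuery (N : ℕ) (b : ℕ → EuclideanSpace ℝ (Fin d)) (T : ℕ) (γ : ℝ)
    (w : EuclideanSpace ℝ (Fin d)) (i : ℕ) (z : Example d R) : ℝ :=
  if margin w z < γ / 2 then
    (1 + label z * coef N b R (z.1 : EuclideanSpace ℝ (Fin d)) i T / (120000 * R)) / 2
  else 0

theorem measurable_errQuery (γ : ℝ) (w : EuclideanSpace ℝ (Fin d)) :
    Measurable (errQuery γ w : Example d R → ℝ) :=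
  Measurable.ite (measurableSet_margin_lt w _) measurable_const measurable_const

theorem measurable_coefQuery (N : ℕ) (b : ℕ → EuclideanSpace ℝ (Fin d)) (T : ℕ) (γ : ℝ)
    (w : EuclideanSpace ℝ (Fin d)) (i : ℕ) :
    Measurable (coefQuery N b T γ w i : Example d R → ℝ) := by
  refine Measurable.ite (measurableSet_margin_lt w _) ?_ measurable_const
  exact ((((measurable_label.mul ((measurable_coef b R i T).comp
    (measurable_subtype_coe.comp measurable_fst))).div_const _).const_add 1).div_const 2)

theorem errQuery_mem (γ : ℝ) (w : EuclideanSpace ℝ (Fin d)) (z : Example d R) :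
    errQuery γ w z ∈ Set.Icc (0 : ℝ) 1 := by
  unfold errQuery; split_ifs <;> simp

/-- Domination by `errQuery` is what makes the tolerance of a coefficient query relative to `p`. -/
theorem coefQuery_nonneg_le (hR : 0 < R) (N : ℕ) (b : ℕ → EuclideanSpace ℝ (Fin d)) (T : ℕ) (γ : ℝ)
    (w : EuclideanSpace ℝ (Fin d)) (i : ℕ) (z : Example d R) :
    0 ≤ coefQuery N b T γ w i z ∧ coefQuery N b T γ w i z ≤ errQuery γ w z := by
  unfold coefQuery errQuery
  split_ifs with h
  · have h1 : |label z * coef N b R (z.1 : EuclideanSpace ℝ (Fin d)) i T / (120000 * R)| ≤ 1 := by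
      rw [abs_div, abs_mul, abs_label, one_mul, abs_of_pos (by positivity : 0 < 120000 * R)]
      exact div_le_one_of_le₀ (abs_coef_le b hR.le _ i T) (by positivity)
    have := abs_le.1 h1
    constructor <;> linarith
  · simp

theorem coefQuery_mem (hR : 0 < R) (N : ℕ) (b : ℕ → EuclideanSpace ℝ (Fin d)) (T : ℕ) (γ : ℝ)
    (w : EuclideanSpace ℝ (Fin d)) (i : ℕ) (z : Example d R) :
    coefQuery N b T γ w i z ∈ Set.Icc (0 : ℝ) 1 :=
  ⟨(coefQuery_nonneg_le hR N b T γ w i z).1,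
    (coefQuery_nonneg_le hR N b T γ w i z).2.trans (errQuery_mem γ w z).2⟩

/-- The factor `500 / 3 = 120000 / 720` combines the scaling of the query with that of the
expansion. -/
theorem errQuery_mul_margin_eq (hR : 0 < R) {N : ℕ} (hN : 0 < N)
    (b : ℕ → EuclideanSpace ℝ (Fin d)) (T : ℕ) (γ : ℝ)
    (w u : EuclideanSpace ℝ (Fin d)) (z : Example d R) :
    errQuery γ w z * margin u z =
      ∑ i ∈ Finset.range N, 500 * R / (3 * N) * (2 * coefQuery N b T γ w i z - errQuery γ w z) *
        inner ℝ (b i) u +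
      errQuery γ w z * label z *
        inner ℝ (resid N b R (z.1 : EuclideanSpace ℝ (Fin d)) T) u := by
  have hN' : (N : ℝ) ≠ 0 := by exact_mod_cast hN.ne'
  have hR' : R ≠ 0 := hR.ne'
  unfold coefQuery errQuery
  split_ifs with h
  · have hx := resid_add_sum_coef (N := N) b R (z.1 : EuclideanSpace ℝ (Fin d)) T
    rw [margin_eq, real_inner_comm]
    conv_lhs => rw [← hx]
    rw [inner_add_left, real_inner_smul_left, sum_inner, mul_add, mul_add, one_mul, add_comm,
      one_mul, one_mul]
    congr 1
    rw [Finset.mul_sum, Finset.mul_sum]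
    refine Finset.sum_congr rfl fun i _ => ?_
    rw [real_inner_smul_left]
    field_simp
    ring
  · simp

theorem integrable_of_abs_le {X : Type*} [MeasurableSpace X] {D : Measure X}
    [IsProbabilityMeasure D] {f : X → ℝ} (hf : Measurable f) {B : ℝ} (hB : ∀ z, |f z| ≤ B) :
    Integrable f D :=
  Integrable.of_bound hf.aestronglyMeasurable B (Filter.Eventually.of_forall hB)

theorem integral_errQuery (D : Measure (Example d R)) (γ : ℝ) (w : EuclideanSpace ℝ (Fin d)) :
    ∫ z, errQuery γ w z ∂D = D.real {z | margin w z < γ / 2} := by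
  have : (fun z => errQuery γ w z) =
      Set.indicator {z : Example d R | margin w z < γ / 2} 1 := by
    funext z
    simp [errQuery, Set.indicator_apply]
  rw [this, integral_indicator_one (measurableSet_margin_lt w _)]

variable (D : Measure (Example d R)) [IsProbabilityMeasure D]

theorem integrable_errQuery (γ : ℝ) (w : EuclideanSpace ℝ (Fin d)) :
    Integrable (errQuery γ w) D :=
  integrable_of_abs_le (measurable_errQuery γ w) (B := 1) fun z => by
    rw [abs_of_nonneg (errQuery_mem γ w z).1]; exact (errQuery_mem γ w z).2

theorem integrable_coefQuery (hR : 0 < R) (N : ℕ) (b : ℕ → EuclideanSpace ℝ (Fin d)) (T : ℕ)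
    (γ : ℝ) (w : EuclideanSpace ℝ (Fin d)) (i : ℕ) :
    Integrable (coefQuery N b T γ w i) D :=
  integrable_of_abs_le (measurable_coefQuery N b T γ w i) (B := 1) fun z => by
    rw [abs_of_nonneg (coefQuery_mem hR N b T γ w i z).1]; exact (coefQuery_mem hR N b T γ w i z).2

theorem integrable_errQuery_mul_margin (γ : ℝ) (w u : EuclideanSpace ℝ (Fin d)) :
    Integrable (fun z => errQuery γ w z * margin u z) D := by
  refine integrable_of_abs_le ((measurable_errQuery γ w).mul (measurable_margin u))
    (B := ‖u‖ * R) fun z => ?_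
  rw [abs_mul, abs_of_nonneg (errQuery_mem γ w z).1]
  exact (mul_le_of_le_one_left (abs_nonneg _) (errQuery_mem γ w z).2).trans (abs_margin_le u z)

/-- Keeps errors proportional to the mass of the examples of small margin. -/
theorem abs_integral_errQuery_mul_le {γ : ℝ} {w : EuclideanSpace ℝ (Fin d)}
    {f : Example d R → ℝ} {B : ℝ} (hf : ∀ z, |f z| ≤ errQuery γ w z * B) :
    |∫ z, f z ∂D| ≤ (∫ z, errQuery γ w z ∂D) * B := by
  rw [← integral_mul_const, ← Real.norm_eq_abs]
  exact norm_integral_le_of_norm_le ((integrable_errQuery D γ w).mul_const B)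
    (Filter.Eventually.of_forall hf)

/-! ### Estimated mean and progress of a step -/

/-- The combination of the frame vectors with the estimated coefficients. -/
noncomputable def estimate (N : ℕ) (b : ℕ → EuclideanSpace ℝ (Fin d)) (R : ℝ) (v0 : ℝ)
    (v : ℕ → ℝ) : EuclideanSpace ℝ (Fin d) :=
  ∑ i ∈ Finset.range N, (500 * R / (3 * N) * (2 * v i - v0)) • b i

/-- One error comes from the answers and is bounded by duality, the other from truncating the
expansion after `T` steps. Testing against `u` avoids vector-valued integrals. -/
theorem abs_inner_estimate_sub_le (hR : 0 < R) {N : ℕ} (hN : 0 < N)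
    {b : ℕ → EuclideanSpace ℝ (Fin d)} (hb : IsKashin N b) (T : ℕ) (γ : ℝ)
    (w u : EuclideanSpace ℝ (Fin d)) {v0 : ℝ} {v : ℕ → ℝ} {η : ℝ} (hη : 0 ≤ η)
    (h0 : |v0 - ∫ z, errQuery γ w z ∂D| ≤ η)
    (hv : ∀ i < N, |v i - ∫ z, coefQuery N b T γ w i z ∂D| ≤ η) :
    |inner ℝ (estimate N b R v0 v) u - ∫ z, errQuery γ w z * margin u z ∂D| ≤
      (1500 * R * η + (∫ z, errQuery γ w z ∂D) * (R * shrink ^ T)) * ‖u‖ := by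
  have hN' : (0 : ℝ) < N := by exact_mod_cast hN
  set p := ∫ z, errQuery γ w z ∂D with hp
  set q : ℕ → ℝ := fun i => ∫ z, coefQuery N b T γ w i z ∂D with hq
  have hint : ∀ i, Integrable (fun z => 500 * R / (3 * N) *
      (2 * coefQuery N b T γ w i z - errQuery γ w z) * inner ℝ (b i) u) D := fun i =>
    ((((integrable_coefQuery D hR N b T γ w i).const_mul 2).sub
      (integrable_errQuery D γ w)).const_mul _).mul_const _
  have hsum : ∫ z, ∑ i ∈ Finset.range N, 500 * R / (3 * N) *
      (2 * coefQuery N b T γ w i z - errQuery γ w z) * inner ℝ (b i) u ∂D =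
      inner ℝ (estimate N b R p q) u := by
    rw [integral_finsetSum _ fun i _ => hint i, estimate, sum_inner]
    refine Finset.sum_congr rfl fun i _ => ?_
    rw [integral_mul_const, integral_const_mul, integral_sub
      ((integrable_coefQuery D hR N b T γ w i).const_mul 2) (integrable_errQuery D γ w),
      integral_const_mul, real_inner_smul_left]
  have htail : |inner ℝ (estimate N b R p q) u - ∫ z, errQuery γ w z * margin u z ∂D| ≤
      p * (R * shrink ^ T * ‖u‖) := by
    rw [← hsum, ← integral_sub (integrable_finsetSum _ fun i _ => hint i)
      (integrable_errQuery_mul_margin D γ w u)]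
    refine abs_integral_errQuery_mul_le D fun z => ?_
    rw [errQuery_mul_margin_eq hR hN b T γ w u z, sub_add_cancel_left, abs_neg, abs_mul, abs_mul,
      abs_label, mul_one, abs_of_nonneg (errQuery_mem γ w z).1]
    refine mul_le_mul_of_nonneg_left ?_ (errQuery_mem γ w z).1
    exact (abs_real_inner_le_norm _ _).trans (mul_le_mul_of_nonneg_right
      (hb.norm_resid_le hN (norm_example_le z) T) (norm_nonneg _))
  have hdiff : estimate N b R v0 v - estimate N b R p q =
      ∑ i ∈ Finset.range N, (500 * R / (3 * N) * (2 * (v i - q i) - (v0 - p))) • b i := by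
    rw [estimate, estimate, ← Finset.sum_sub_distrib]
    refine Finset.sum_congr rfl fun i _ => ?_
    rw [← sub_smul]
    congr 1
    ring
  have herr : ‖estimate N b R v0 v - estimate N b R p q‖ ≤ 1500 * R * η := by
    rw [hdiff]
    -- Each `2 (v i - q i) - (v0 - p)` is at most `3 η` in absolute value, and `3 N * (500 R / (3
    -- N)) * 3 η = 1500 R η`.
    refine (hb.norm_sum_smul_le (η := 500 * R / (3 * N) * (3 * η)) (fun i hi => ?_)
      (by positivity)).trans (le_of_eq (by field_simp; ring))
    rw [abs_mul, abs_of_nonneg (by positivity : 0 ≤ 500 * R / (3 * (N : ℝ)))]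
    refine mul_le_mul_of_nonneg_left ?_ (by positivity)
    have h1 := abs_le.1 (hv i hi)
    have h2 := abs_le.1 h0
    rw [abs_le]
    constructor <;> simp only [hq] <;> linarith [h1.1, h1.2, h2.1, h2.2]
  have hfin : |inner ℝ (estimate N b R v0 v) u - inner ℝ (estimate N b R p q) u| ≤
      1500 * R * η * ‖u‖ := by
    rw [← inner_sub_left]
    exact (abs_real_inner_le_norm _ _).trans (mul_le_mul_of_nonneg_right herr (norm_nonneg _))
  calc _ ≤ _ := abs_sub_le _ (inner ℝ (estimate N b R p q) u) _
    _ ≤ 1500 * R * η * ‖u‖ + p * (R * shrink ^ T * ‖u‖) := add_le_add hfin htail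
    _ = _ := by ring

/-- A step of the perceptron brings the vector `w` closer to every vector of margin `γ`. -/
theorem norm_perceptron_step_le (hR : 0 < R) {W γ : ℝ} (hγ : 0 < γ) (hW : 0 < W)
    (hWR : γ ≤ W * R) {N : ℕ} (hN : 0 < N)
    {b : ℕ → EuclideanSpace ℝ (Fin d)} (hb : IsKashin N b) {T : ℕ}
    (hT : 32 * W * (R * shrink ^ T) ≤ γ) {w wstar : EuclideanSpace ℝ (Fin d)}
    (hstar : ∀ᵐ z ∂D, γ ≤ margin wstar z) (hw : ‖w - wstar‖ ≤ W) {v0 : ℝ} {v : ℕ → ℝ} {θ : ℝ}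
    (hθ0 : 0 ≤ θ) (hθ : θ * (W * R) * 500000 ≤ γ)
    (hp : 0 < ∫ z, errQuery γ w z ∂D)
    (h0 : |v0 - ∫ z, errQuery γ w z ∂D| ≤ θ * ∫ z, errQuery γ w z ∂D)
    (hv : ∀ i < N, |v i - ∫ z, coefQuery N b T γ w i z ∂D| ≤ θ * ∫ z, errQuery γ w z ∂D) :
    ‖w + (γ / (8 * R ^ 2) / v0) • estimate N b R v0 v - wstar‖ ^ 2 ≤
      ‖w - wstar‖ ^ 2 - γ ^ 2 / (32 * R ^ 2) := by
  have hmain := fun u => abs_inner_estimate_sub_le D hR hN hb T γ w u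
    (mul_nonneg hθ0 hp.le) h0 hv
  set p := ∫ z, errQuery γ w z ∂D with hpdef
  set g := estimate N b R v0 v with hg
  -- Truncation contributes `γ / (32 W)`, the answers at most `1500 γ / (500000 W)`; together this
  -- is below `γ / (16 W)`.
  have hbound : 1500 * R * (θ * p) + p * (R * shrink ^ T) ≤ p * (γ / (16 * W)) := by
    have h1 : 1500 * R * θ + R * shrink ^ T ≤ γ / (16 * W) := by
      rw [le_div_iff₀ (by positivity)]
      nlinarith
    nlinarith
  have hmain' : ∀ u, |inner ℝ g u - ∫ z, errQuery γ w z * margin u z ∂D| ≤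
      p * (γ / (16 * W)) * ‖u‖ := fun u =>
    (hmain u).trans (mul_le_mul_of_nonneg_right hbound (norm_nonneg _))
  have hstar' : p * γ ≤ ∫ z, errQuery γ w z * margin wstar z ∂D := by
    rw [hpdef, ← integral_mul_const]
    refine integral_mono_ae ((integrable_errQuery D γ w).mul_const γ)
      (integrable_errQuery_mul_margin D γ w wstar) ?_
    filter_upwards [hstar] with z hz
    exact mul_le_mul_of_nonneg_left hz (errQuery_mem γ w z).1
  have hw' : ∫ z, errQuery γ w z * margin w z ∂D ≤ p * (γ / 2) := by
    rw [hpdef, ← integral_mul_const]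
    refine integral_mono (integrable_errQuery_mul_margin D γ w w)
      ((integrable_errQuery D γ w).mul_const _) fun z => ?_
    simp only [errQuery]
    split_ifs with h <;> simp
    exact h.le
  -- The factor is `1 / 2 - 1 + 1 / 16`: margin of `w`, margin of `wstar`, estimation error.
  have hlin : inner ℝ g (w - wstar) ≤ -(7 / 16) * (p * γ) := by
    have h1 := (abs_le.1 (hmain' (w - wstar))).2
    have h2 : ∫ z, errQuery γ w z * margin (w - wstar) z ∂D =
        ∫ z, errQuery γ w z * margin w z ∂D - ∫ z, errQuery γ w z * margin wstar z ∂D := by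
      rw [← integral_sub (integrable_errQuery_mul_margin D γ w w)
        (integrable_errQuery_mul_margin D γ w wstar)]
      refine integral_congr_ae (Filter.Eventually.of_forall fun z => ?_)
      simp only [margin_eq, inner_sub_left]
      ring
    rw [h2] at h1
    have h3 : p * (γ / (16 * W)) * ‖w - wstar‖ ≤ p * (γ / (16 * W)) * W :=
      mul_le_mul_of_nonneg_left hw (by positivity)
    have h4 : p * (γ / (16 * W)) * W = p * γ / 16 := by field_simp
    linarith
  -- The error bound is applied in the direction of `g` itself.
  have hnorm : ‖g‖ ≤ 17 / 16 * (p * R) := by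
    rcases eq_or_ne g 0 with h | h
    · rw [h, norm_zero]; positivity
    have hgp : 0 < ‖g‖ := norm_pos_iff.2 h
    have h1 := (abs_le.1 (hmain' g)).2
    have h2 : |∫ z, errQuery γ w z * margin g z ∂D| ≤ p * (‖g‖ * R) := by
      refine abs_integral_errQuery_mul_le D fun z => ?_
      rw [abs_mul, abs_of_nonneg (errQuery_mem γ w z).1]
      exact mul_le_mul_of_nonneg_left (abs_margin_le g z) (errQuery_mem γ w z).1
    have h3 := (abs_le.1 h2).2
    rw [real_inner_self_eq_norm_mul_norm] at h1
    have h4 : γ / (16 * W) ≤ R / 16 := by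
      rw [div_le_iff₀ (by positivity)]; linarith
    have h5 : p * (γ / (16 * W)) * ‖g‖ ≤ p * (R / 16) * ‖g‖ :=
      mul_le_mul_of_nonneg_right (mul_le_mul_of_nonneg_left h4 hp.le) hgp.le
    refine le_of_mul_le_mul_right ?_ hgp
    linarith
  have hθ' : θ ≤ 1 / 500000 := by
    have : θ * γ * 500000 ≤ γ := by nlinarith
    rw [le_div_iff₀ (by norm_num)]
    exact le_of_mul_le_mul_right (by linarith) hγ
  have hv0 := abs_le.1 h0
  have hθp : θ * p ≤ 1 / 500000 * p := mul_le_mul_of_nonneg_right hθ' hp.le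
  have hv0l : p / 2 ≤ v0 := by linarith
  have hv0u : v0 ≤ 2 * p := by linarith
  have hv0p : 0 < v0 := by linarith
  set μ := γ / (8 * R ^ 2) / v0 with hμ
  have hμp : 0 < μ := by positivity
  -- As `v0` is within a factor of two of `p`, `μ p` lies between `γ / (16 R²)` and `γ / (4 R²)`.
  have hμ1 : γ / (16 * R ^ 2) ≤ μ * p := by
    rw [hμ, div_div, div_mul_eq_mul_div, div_le_div_iff₀ (by positivity) (by positivity)]
    nlinarith [mul_nonneg hγ.le (sq_nonneg R), mul_nonneg (mul_nonneg hγ.le (sq_nonneg R))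
      (sub_nonneg.2 hv0u)]
  have hμ2 : μ * p * R ^ 2 ≤ γ / 4 := by
    have : μ * p * R ^ 2 = γ / 8 * (p / v0) := by rw [hμ]; field_simp
    rw [this]
    have : p / v0 ≤ 2 := by rw [div_le_iff₀ hv0p]; linarith
    nlinarith
  have e : w + μ • g - wstar = (w - wstar) + μ • g := by abel
  rw [e, norm_add_sq_real, inner_smul_right, real_inner_comm, norm_smul, mul_pow,
    Real.norm_of_nonneg hμp.le]
  -- In units of `μ p γ`, the linear term is at most `-7 / 8` and the quadratic one at most `289 /
  -- 1024`, so more than `1 / 2` is gained.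
  have h1 : μ * inner ℝ g (w - wstar) ≤ μ * (-(7 / 16) * (p * γ)) :=
    mul_le_mul_of_nonneg_left hlin hμp.le
  have h2 : μ ^ 2 * ‖g‖ ^ 2 ≤ μ ^ 2 * (17 / 16 * (p * R)) ^ 2 :=
    mul_le_mul_of_nonneg_left (pow_le_pow_left₀ (norm_nonneg _) hnorm 2) (sq_nonneg _)
  have h3 : μ ^ 2 * (17 / 16 * (p * R)) ^ 2 = 289 / 256 * (μ * p) * (μ * p * R ^ 2) := by ring
  have hμp0 : 0 < μ * p := mul_pos hμp hp
  have h4 : 289 / 256 * (μ * p) * (μ * p * R ^ 2) ≤ 289 / 256 * (μ * p) * (γ / 4) :=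
    mul_le_mul_of_nonneg_left hμ2 (by positivity)
  have h5 : γ ^ 2 / (32 * R ^ 2) ≤ 1 / 2 * (μ * p) * γ := by
    have : γ ^ 2 / (32 * R ^ 2) = 1 / 2 * (γ / (16 * R ^ 2)) * γ := by field_simp; ring
    rw [this]
    nlinarith
  have h6 : 0 < μ * p * γ := mul_pos hμp0 hγ
  linarith

end step

/-! ### Tolerance of the oracle -/

section tolerance

variable {κ ε n p : ℝ}

theorem inv_le_of_sampleSize (hκ : 1 ≤ κ) (hε : 0 < ε) (hn : 10 ^ 12 * κ ^ 2 / ε ≤ n) :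
    1 / n ≤ ε / (10 ^ 12 * κ ^ 2) := by
  have h : 0 < 10 ^ 12 * κ ^ 2 / ε := by positivity
  have := one_div_le_one_div_of_le h hn
  rwa [one_div_div] at this

/-- The variance term is at most `p / n ≤ 4 p² / (10 ^ 12 κ²)`, the square of `p / (500000 κ)`. -/
theorem tolerance_le (hκ : 1 ≤ κ) (hε : 0 < ε) (hn : 10 ^ 12 * κ ^ 2 / ε ≤ n)
    (hp : ε / 4 ≤ p) {q : ℝ} (hq0 : 0 ≤ q) (hqp : q ≤ p) :
    max (1 / n) (Real.sqrt (q * (1 - q) / n)) ≤ 1 / (500000 * κ) * p := by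
  have h1 := inv_le_of_sampleSize hκ hε hn
  have hκ0 : 0 < κ := by linarith
  have hp0 : 0 < p := by linarith
  have hn0 : 0 < n := lt_of_lt_of_le (by positivity) hn
  have h2 : 1 / n ≤ 4 * p / (10 ^ 12 * κ ^ 2) := h1.trans (by gcongr; linarith)
  refine max_le (h2.trans ?_) ?_
  · rw [div_mul_eq_mul_div, div_le_div_iff₀ (by positivity) (by positivity)]
    nlinarith [mul_pos hp0 hκ0]
  · refine Real.sqrt_le_iff.2 ⟨by positivity, ?_⟩
    have h3 : q * (1 - q) / n ≤ p * (1 / n) := by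
      rw [mul_one_div]
      gcongr
      nlinarith
    refine h3.trans ((mul_le_mul_of_nonneg_left h2 hp0.le).trans (le_of_eq ?_))
    field_simp
    norm_num

/-- For `p < ε / 4` the tolerance is at most `ε / 8`, so the answer stays below `3 ε / 8`. -/
theorem quarter_le_of_answer (hκ : 1 ≤ κ) (hε : 0 < ε) (hn : 10 ^ 12 * κ ^ 2 / ε ≤ n)
    (hp0 : 0 ≤ p) {v : ℝ}
    (hv : |v - p| ≤ max (1 / n) (Real.sqrt (p * (1 - p) / n))) (h : ε / 2 < v) : ε / 4 ≤ p := by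
  by_contra! hp
  have h1 := inv_le_of_sampleSize hκ hε hn
  have hn0 : 0 < n := lt_of_lt_of_le (by positivity) hn
  have h2 : 1 / n ≤ ε / 64 := by
    refine h1.trans ?_
    gcongr
    nlinarith
  have h3 : max (1 / n) (Real.sqrt (p * (1 - p) / n)) ≤ ε / 8 := by
    refine max_le (by linarith) (Real.sqrt_le_iff.2 ⟨by positivity, ?_⟩)
    have h3 : p * (1 - p) / n ≤ p * (1 / n) := by
      rw [mul_one_div]
      gcongr
      nlinarith
    nlinarith [mul_le_mul_of_nonneg_left h2 hp0]
  linarith [(abs_le.1 (hv.trans h3)).2]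

/-- For `p > ε` the relative error is at most `1 / 2`, so the answer would exceed `ε / 2`. -/
theorem le_of_answer_le (hκ : 1 ≤ κ) (hε : 0 < ε) (hn : 10 ^ 12 * κ ^ 2 / ε ≤ n)
    (hp0 : 0 ≤ p) {v : ℝ}
    (hv : |v - p| ≤ max (1 / n) (Real.sqrt (p * (1 - p) / n))) (h : v ≤ ε / 2) : p ≤ ε := by
  by_contra! hp
  have h1 := hv.trans (tolerance_le hκ hε hn (by linarith) hp0 le_rfl)
  have h2 : 1 / (500000 * κ) * p ≤ 1 / 2 * p := by
    refine mul_le_mul_of_nonneg_right ?_ hp0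
    exact one_div_le_one_div_of_le (by norm_num) (by linarith)
  linarith [(abs_le.1 h1).1]

end tolerance

/-! ### Total correctness with a time bound -/

/-- Started in memory `m` after `k` questions, the program `c` halts after at most `T` steps, and
the memory and the number of questions are then as required by `Q`. -/
def Runs {A : Type} (H : ℕ → A → Mem → ℕ → ℝ → Prop) (c : Prog A) (m : Mem) (k T : ℕ)
    (Q : Mem → ℕ → Prop) : Prop :=
  ∃ t ≤ T, ∃ m' k', Exec H c m k t m' k' ∧ Q m' k'

section runs

variable {A : Type} {H : ℕ → A → Mem → ℕ → ℝ → Prop} {m : Mem} {k T T₁ T₂ : ℕ}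
  {Q Q' : Mem → ℕ → Prop} {c c₁ c₂ : Prog A}

theorem Runs.mono (h : Runs H c m k T₁ Q') (hT : T₁ ≤ T) (hQ : ∀ m' k', Q' m' k' → Q m' k') :
    Runs H c m k T Q := by
  obtain ⟨t, ht, m', k', he, hq⟩ := h
  exact ⟨t, ht.trans hT, m', k', he, hQ _ _ hq⟩

theorem Runs.nset {r : ℕ} {e : NExpr} (h : Q (m.setNat r (e.eval m)) k) :
    Runs H (Prog.nset r e) m k 1 Q :=
  ⟨1, le_rfl, _, _, Exec.nset r e m k, h⟩

theorem Runs.rset {a : ℕ} {i : NExpr} {e : RExpr} (h : Q (m.setReal a (i.eval m) (e.eval m)) k) :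
    Runs H (Prog.rset a i e) m k 1 Q :=
  ⟨1, le_rfl, _, _, Exec.rset a i e m k, h⟩

theorem Runs.seq (h : Runs H c₁ m k T₁ fun m₁ k₁ => Runs H c₂ m₁ k₁ T₂ Q) :
    Runs H (Prog.seq c₁ c₂) m k (T₁ + T₂) Q := by
  obtain ⟨t₁, ht₁, m₁, k₁, he₁, t₂, ht₂, m₂, k₂, he₂, hq⟩ := h
  exact ⟨_, Nat.add_le_add ht₁ ht₂, m₂, k₂, Exec.seq he₁ he₂, hq⟩

theorem Runs.cond {b : Test} (h₁ : b.Holds m → Runs H c₁ m k T Q)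
    (h₂ : ¬ b.Holds m → Runs H c₂ m k T Q) : Runs H (Prog.cond b c₁ c₂) m k (T + 1) Q := by
  by_cases hb : b.Holds m
  · obtain ⟨t, ht, m', k', he, hq⟩ := h₁ hb
    exact ⟨_, Nat.add_le_add_right ht 1, m', k', Exec.condTrue hb he, hq⟩
  · obtain ⟨t, ht, m', k', he, hq⟩ := h₂ hb
    exact ⟨_, Nat.add_le_add_right ht 1, m', k', Exec.condFalse hb he, hq⟩

theorem Runs.ask {q : A} {a : ℕ} {e : NExpr} {v : ℝ} (hv : H k q m T v)
    (h : Q (m.setReal a (e.eval m) v) (k + 1)) : Runs H (Prog.ask q a e) m k (T + 1) Q :=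
  ⟨_, le_rfl, _, _, Exec.ask hv, h⟩

/-- The invariant carries the iteration index. That the test forces `j < J` makes `J - j` a
termination measure and bounds the time. -/
theorem Runs.loop {b : Test} {I : ℕ → Mem → ℕ → Prop} {J : ℕ}
    (hlt : ∀ j m k, I j m k → b.Holds m → j < J)
    (hbody : ∀ j m k, I j m k → b.Holds m → Runs H c m k T (I (j + 1)))
    {j : ℕ} (h : I j m k) :
    Runs H (Prog.loop b c) m k ((J - j) * (T + 1) + 1) fun m' k' =>
      ∃ j', I j' m' k' ∧ ¬ b.Holds m' := by
  induction hn : J - j generalizing j m k with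
  | zero =>
    have hb : ¬ b.Holds m := fun hb => by have := hlt j m k h hb; omega
    exact ⟨1, by omega, m, k, Exec.loopDone hb, j, h, hb⟩
  | succ n ih =>
    by_cases hb : b.Holds m
    · obtain ⟨t₁, ht₁, m₁, k₁, he₁, hI⟩ := hbody j m k h hb
      obtain ⟨t₂, ht₂, m₂, k₂, he₂, hq⟩ := ih hI (by omega)
      refine ⟨_, ?_, m₂, k₂, Exec.loopStep hb he₁ he₂, hq⟩
      rw [Nat.succ_mul]
      omega
    · exact ⟨1, by omega, m, k, Exec.loopDone hb, j, h, hb⟩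

/-- The program that runs `c` with the register `r` set to `0, 1, …` below `bound`. -/
def forRange (r : ℕ) (bound : NExpr) (c : Prog A) : Prog A :=
  .seq (.nset r (.lit 0))
    (.loop (.natLt (.reg r) bound) (.seq c (.nset r (.add (.reg r) (.lit 1)))))

theorem Runs.forRange {r : ℕ} {bound : NExpr} {I : ℕ → Mem → ℕ → Prop} {n : ℕ}
    (hreg : ∀ j m k, I j m k → m.nat r = j ∧ bound.eval m = n)
    (hbody : ∀ j m k, j < n → I j m k →
      Runs H c m k T fun m' k' => I (j + 1) (m'.setNat r (m'.nat r + 1)) k')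
    (h0 : I 0 (m.setNat r 0) k) (hn : ∀ m' k', I n m' k' → Q m' k') :
    Runs H (forRange r bound c) m k (n * (T + 2) + 2) Q := by
  have hloop := Runs.loop (H := H) (c := .seq c (.nset r (.add (.reg r) (.lit 1)))) (T := T + 1)
    (b := .natLt (.reg r) bound) (I := fun j m k => I j m k ∧ j ≤ n) (J := n)
    (fun j m k hI hb => by
      have := hreg j m k hI.1
      simp only [Test.Holds, NExpr.eval] at hb
      omega)
    (fun j m k hI hb => by
      have hr := hreg j m k hI.1
      simp only [Test.Holds, NExpr.eval] at hb
      have hj : j < n := by omega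
      refine Runs.seq ((hbody j m k hj hI.1).mono le_rfl fun m' k' h => ?_)
      exact Runs.nset ⟨h, hj⟩)
    (j := 0) ⟨h0, Nat.zero_le _⟩
  refine (Runs.seq (T₁ := 1) (Runs.nset hloop)).mono (by rw [Nat.sub_zero]; linarith) ?_
  rintro m' k' ⟨j, ⟨hI, hj⟩, hb⟩
  have hr := hreg j m' k' hI
  simp only [Test.Holds, NExpr.eval] at hb
  have : j = n := by omega
  exact hn m' k' (this ▸ hI)

/-! ### Memory updates and summation loops -/

@[simp] theorem Mem.setNat_nat (m : Mem) (r v r' : ℕ) :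
    (m.setNat r v).nat r' = if r' = r then v else m.nat r' := by
  simp [Mem.setNat, Function.update_apply]

@[simp] theorem Mem.setNat_real (m : Mem) (r v : ℕ) : (m.setNat r v).real = m.real := rfl

@[simp] theorem Mem.setReal_nat (m : Mem) (a i : ℕ) (v : ℝ) : (m.setReal a i v).nat = m.nat := rfl

@[simp] theorem Mem.setReal_real (m : Mem) (a i : ℕ) (v : ℝ) (a' i' : ℕ) :
    (m.setReal a i v).real a' i' = if a' = a ∧ i' = i then v else m.real a' i' := by
  by_cases ha : a' = a
  · subst ha
    simp [Mem.setReal, Function.update_apply]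
  · simp [Mem.setReal, ha]

/-- The program that puts the sum of the values of `e`, with the register `r` running over the
numbers below `bound`, into cell `0` of the array `a`. -/
def sumTo (a r : ℕ) (bound : NExpr) (e : RExpr) : Prog A :=
  .seq (.rset a (.lit 0) (.ofNat (.lit 0)))
    (forRange r bound (.rset a (.lit 0) (.add (.cell a (.lit 0)) e)))

/-- In `hbound` and `he` the accumulator holds an arbitrary `s`: neither the bound nor the summand
may depend on it. -/
theorem Runs.sumTo {a r : ℕ} {bound : NExpr} {e : RExpr} {n : ℕ} (f : ℕ → ℝ)
    (hbound : ∀ j s, bound.eval ((m.setNat r j).setReal a 0 s) = n)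
    (he : ∀ j < n, ∀ s, e.eval ((m.setNat r j).setReal a 0 s) = f j)
    (hQ : Q ((m.setNat r n).setReal a 0 (∑ j ∈ Finset.range n, f j)) k) :
    Runs H (sumTo a r bound e) m k (3 * n + 3) Q := by
  have h := Runs.forRange (H := H) (T := 1) (c := .rset a (.lit 0) (.add (.cell a (.lit 0)) e))
    (m := m.setReal a 0 0) (k := k) (r := r) (bound := bound) (n := n) (Q := Q)
    (I := fun j m' k' => m' = (m.setNat r j).setReal a 0 (∑ l ∈ Finset.range j, f l) ∧ k' = k)
    (by
      rintro j m' k' ⟨rfl, -⟩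
      exact ⟨by simp, hbound _ _⟩)
    (by
      rintro j m' k' hj ⟨rfl, rfl⟩
      refine Runs.rset ⟨?_, rfl⟩
      simp only [RExpr.eval, NExpr.eval, he j hj, Finset.sum_range_succ]
      simp [Mem.setReal, Mem.setNat])
    (by
      refine ⟨?_, rfl⟩
      simp [Mem.setReal, Mem.setNat])
    (by
      rintro m' k' ⟨rfl, rfl⟩
      exact hQ)
  refine (Runs.seq (T₁ := 1) (Runs.rset (i := .lit 0) (e := .ofNat (.lit 0)) ?_)).mono
    (T₁ := 1 + (n * (1 + 2) + 2)) (by omega) fun _ _ h => h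
  simpa [RExpr.eval, NExpr.eval] using h

/-- No question can be answered here; this fits `Runs` to the fixed counts in `Code.Run`. -/
theorem Exec.code_count {c : Code} {m m' : Mem} {k k' t : ℕ}
    (h : Exec (fun _ _ _ _ _ => False) c m k t m' k') : k' = k := by
  induction h with
  | ask h => exact h.elim
  | seq _ _ h₁ h₂ => rw [h₂, h₁]
  | condTrue _ _ h => exact h
  | condFalse _ _ h => exact h
  | loopStep _ _ _ h₁ h₂ => rw [h₂, h₁]
  | _ => rfl

end runs

/-! ### The codes of the queries -/

/-- The number of rows of the sign matrix. -/
def numRows : NExpr := .mul (.lit 2000) (.reg 0)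

/-- The entry in row `l` and column `j` of the sign matrix. -/
def signEntry (l j : NExpr) : RExpr :=
  .sub (.mul (.ofNat (.lit 2)) (.cell seedArr (.add (.mul l (.reg 0)) j))) (.ofNat (.lit 1))

def natR (n : ℕ) : RExpr := .ofNat (.lit n)

/-- Leaves the margin of the example in cell 0 of array 6. -/
def marginCode : Code :=
  .seq (sumTo 6 2 (.reg 0) (.mul (.cell outArr (.reg 2)) (.cell pointArr (.reg 2))))
    (.rset 6 (.lit 0) (.mul (.cell 6 (.lit 0)) (.cell labelArr (.lit 0))))

/-- Leaves in array 9 the signs of the inner products of the rows with the residual. -/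
def signsCode : Code :=
  forRange 3 numRows
    (.seq (sumTo 6 2 (.reg 0) (.mul (signEntry (.reg 3) (.reg 2)) (.cell pointArr (.reg 2))))
      (.cond (.realLt (.cell 6 (.lit 0)) (natR 0))
        (.rset 9 (.reg 3) (.sub (natR 0) (natR 1))) (.rset 9 (.reg 3) (natR 1))))

/-- Replaces the residual by the next one. -/
def residCode : Code :=
  forRange 2 (.reg 0)
    (.seq (sumTo 6 3 numRows (.mul (.cell 9 (.reg 3)) (signEntry (.reg 3) (.reg 2))))
      (.rset pointArr (.reg 2) (.sub (.cell pointArr (.reg 2))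
        (.mul (.div (.cell 7 (.lit 0)) (.mul (natR 720) (.ofNat numRows))) (.cell 6 (.lit 0))))))

/-- Adds the next term to the coefficient and shrinks the bound on the residual. -/
def coefStepCode : Code :=
  .seq (.rset 8 (.lit 0) (.add (.cell 8 (.lit 0)) (.mul (.cell 7 (.lit 0)) (.cell 9 (.reg 1)))))
    (.rset 7 (.lit 0) (.mul (.cell 7 (.lit 0)) (.sub (natR 1) (.div (natR 1) (natR 120000)))))

/-- Expands the example until the residual is short enough. -/
def expandCode : Code :=
  .seq (.rset 7 (.lit 0) (.cell paramArr (.lit 0)))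
    (.seq (.rset 8 (.lit 0) (natR 0))
      (.loop (.realLt (.cell paramArr (.lit 2))
          (.mul (.mul (natR 32) (.cell paramArr (.lit 1))) (.cell 7 (.lit 0))))
        (.seq signsCode (.seq residCode coefStepCode))))

/-- The test whether the margin is below `γ / 2`. -/
def smallMargin : Test :=
  .realLt (.cell 6 (.lit 0)) (.div (.cell paramArr (.lit 2)) (natR 2))

def errCode : Code :=
  .seq marginCode
    (.cond smallMargin (.rset valueArr (.lit 0) (natR 1)) (.rset valueArr (.lit 0) (natR 0)))

def coefCode : Code :=
  .seq marginCode
    (.cond smallMargin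
      (.seq expandCode
        (.rset valueArr (.lit 0)
          (.div (.add (natR 1) (.div (.mul (.cell labelArr (.lit 0)) (.cell 8 (.lit 0)))
            (.mul (natR 120000) (.cell paramArr (.lit 0))))) (natR 2))))
      (.rset valueArr (.lit 0) (natR 0)))

/-- What the codes of the queries do not change. -/
structure QEnv (d i : ℕ) (R W γ : ℝ) (s : ℕ → ℝ) (y : ℝ) (m : Mem) : Prop where
  dim : m.nat 0 = d
  index : m.nat 1 = i
  radius : m.real paramArr 0 = R
  bound : m.real paramArr 1 = W
  margin : m.real paramArr 2 = γ
  seed : m.real seedArr = s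
  label : m.real labelArr 0 = y

/-- The array `a` holds the coordinates of the vector `v`. -/
def IsVec {d : ℕ} (m : Mem) (a : ℕ) (v : EuclideanSpace ℝ (Fin d)) : Prop :=
  ∀ j : Fin d, m.real a j = v j

section codes

variable {d i : ℕ} {R W γ y : ℝ} {s : ℕ → ℝ} {m : Mem}

theorem QEnv.setNat (h : QEnv d i R W γ s y m) {r v : ℕ} (hr : 2 ≤ r) :
    QEnv d i R W γ s y (m.setNat r v) := by
  obtain ⟨h1, h2, h3, h4, h5, h6, h7⟩ := h
  refine ⟨?_, ?_, h3, h4, h5, h6, h7⟩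
  · rw [Mem.setNat_nat, if_neg (by omega), h1]
  · rw [Mem.setNat_nat, if_neg (by omega), h2]

theorem Mem.setReal_real_of_ne (m : Mem) {a a' : ℕ} (h : a' ≠ a) (i : ℕ) (v : ℝ) :
    (m.setReal a i v).real a' = m.real a' := by
  simp [Mem.setReal, h]

theorem QEnv.setReal (h : QEnv d i R W γ s y m) {a c : ℕ} {v : ℝ} (h0 : paramArr ≠ a)
    (h1 : seedArr ≠ a) (h4 : labelArr ≠ a) : QEnv d i R W γ s y (m.setReal a c v) := by
  constructor
  · exact h.dim
  · exact h.index
  · rw [Mem.setReal_real_of_ne _ h0, h.radius]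
  · rw [Mem.setReal_real_of_ne _ h0, h.bound]
  · rw [Mem.setReal_real_of_ne _ h0, h.margin]
  · rw [Mem.setReal_real_of_ne _ h1, h.seed]
  · rw [Mem.setReal_real_of_ne _ h4, h.label]

theorem IsVec.setReal {v : EuclideanSpace ℝ (Fin d)} {a a' c : ℕ} {x : ℝ} (h : IsVec m a v)
    (ha : a ≠ a') : IsVec (m.setReal a' c x) a v := fun j => by
  rw [Mem.setReal_real_of_ne _ ha]; exact h j

theorem signEntry_eval {l j : NExpr} {l' j' : ℕ} (hl : l.eval m = l') (hj : j.eval m = j') :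
    (signEntry l j).eval m = 2 * m.real seedArr (l' * m.nat 0 + j') - 1 := by
  simp [signEntry, RExpr.eval, NExpr.eval, hl, hj]

theorem inner_eq_sum_range (v w : EuclideanSpace ℝ (Fin d)) {f : ℕ → ℝ}
    (hf : ∀ j : Fin d, f j = v j * w j) :
    inner ℝ v w = ∑ j ∈ Finset.range d, f j := by
  rw [PiLp.inner_apply, Finset.sum_range]
  exact Finset.sum_congr rfl fun j _ => by rw [hf]; simp [mul_comm]

theorem marginCode_runs {H : ℕ → Empty → Mem → ℕ → ℝ → Prop} {w x : EuclideanSpace ℝ (Fin d)}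
    {k : ℕ} {Q : Mem → ℕ → Prop} (h : QEnv d i R W γ s y m) (hw : IsVec m outArr w)
    (hx : IsVec m pointArr x)
    (hQ : ∀ m', QEnv d i R W γ s y m' → IsVec m' pointArr x →
      m'.real 6 0 = y * inner ℝ w x → Q m' k) :
    Runs H marginCode m k (3 * d + 4) Q := by
  refine (Runs.seq (T₂ := 1) (Runs.sumTo (n := d)
    (fun j => m.real outArr j * m.real pointArr j) ?_ ?_ (Runs.rset (hQ _ ?_ ?_ ?_)))).mono
    (by omega) fun _ _ h => h
  · intro j s
    simp [NExpr.eval, h.dim]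
  · intro j _ s
    simp [RExpr.eval, NExpr.eval, outArr, pointArr]
  · exact ((h.setNat le_rfl).setReal (by decide) (by decide) (by decide)).setReal (by decide)
      (by decide) (by decide)
  · exact IsVec.setReal (IsVec.setReal hx (by decide)) (by decide)
  · rw [inner_eq_sum_range w x (f := fun j => m.real outArr j * m.real pointArr j)
      fun j => by rw [hw j, hx j]]
    simp [RExpr.eval, NExpr.eval, labelArr]
    rw [mul_comm]
    congr 1
    exact h.label

/-- The memory in which the expansion has been carried out up to the residual `r`. -/
structure ExpandInv (d i : ℕ) (R W γ : ℝ) (s : ℕ → ℝ) (y : ℝ) (r : EuclideanSpace ℝ (Fin d))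
    (ρ a : ℝ) (m : Mem) : Prop where
  env : QEnv d i R W γ s y m
  vec : IsVec m pointArr r
  len : m.real 7 0 = ρ
  acc : m.real 8 0 = a

variable {r : EuclideanSpace ℝ (Fin d)} {ρ a : ℝ}

theorem ExpandInv.setNat (h : ExpandInv d i R W γ s y r ρ a m) {q v : ℕ} (hq : 2 ≤ q) :
    ExpandInv d i R W γ s y r ρ a (m.setNat q v) :=
  ⟨h.env.setNat hq, h.vec, h.len, h.acc⟩

theorem ExpandInv.setReal (h : ExpandInv d i R W γ s y r ρ a m) {b c : ℕ} {v : ℝ}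
    (hb : b = 6 ∨ b = 9) : ExpandInv d i R W γ s y r ρ a (m.setReal b c v) := by
  have h0 : paramArr ≠ b := by rcases hb with rfl | rfl <;> decide
  have h1 : seedArr ≠ b := by rcases hb with rfl | rfl <;> decide
  have h4 : labelArr ≠ b := by rcases hb with rfl | rfl <;> decide
  have h3 : pointArr ≠ b := by rcases hb with rfl | rfl <;> decide
  refine ⟨h.env.setReal h0 h1 h4, h.vec.setReal h3, ?_, ?_⟩
  · rw [Mem.setReal_real_of_ne _ (by omega), h.len]
  · rw [Mem.setReal_real_of_ne _ (by omega), h.acc]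

theorem signsCode_runs {H : ℕ → Empty → Mem → ℕ → ℝ → Prop} {k : ℕ} {Q : Mem → ℕ → Prop}
    (h : ExpandInv d i R W γ s y r ρ a m)
    (hQ : ∀ m', ExpandInv d i R W γ s y r ρ a m' →
      (∀ l < 2000 * d, m'.real 9 l = sgn (inner ℝ (bitRow d s l) r)) → Q m' k) :
    Runs H signsCode m k (2000 * d * (3 * d + 7) + 2) Q := by
  refine Runs.forRange (n := 2000 * d) (T := 3 * d + 5)
    (I := fun j m' k' => ExpandInv d i R W γ s y r ρ a m' ∧ m'.nat 3 = j ∧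
      (∀ l < j, m'.real 9 l = sgn (inner ℝ (bitRow d s l) r)) ∧ k' = k) ?_ ?_ ?_ ?_
  · rintro j m' k' ⟨hI, hj, -, -⟩
    exact ⟨hj, by simp [numRows, NExpr.eval, hI.env.dim]⟩
  · rintro l m' k' - ⟨hI, hl, hs, rfl⟩
    refine (Runs.seq (T₂ := 2) (Runs.sumTo (n := d)
      (fun j => (2 * s (l * d + j) - 1) * m'.real pointArr j) ?_ ?_ ?_)).mono
      (by omega) fun _ _ h => h
    · intro j t
      simp [NExpr.eval, hI.env.dim]
    · intro j _ t
      rw [RExpr.eval, signEntry_eval (l' := l) (j' := j) (by simp [NExpr.eval, hl])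
        (by simp [NExpr.eval])]
      simp only [Mem.setReal_nat, Mem.setNat_nat, RExpr.eval, NExpr.eval]
      rw [Mem.setReal_real_of_ne _ (by decide), Mem.setReal_real_of_ne _ (by decide)]
      simp [hI.env.seed, hI.env.dim]
    · have hsum : ∑ j ∈ Finset.range d, (2 * s (l * d + j) - 1) * m'.real pointArr j =
          inner ℝ (bitRow d s l) r :=
        (inner_eq_sum_range _ _ fun j => by rw [hI.vec j]; rfl).symm
      rw [hsum]
      set m₁ := (m'.setNat 2 d).setReal 6 0 (inner ℝ (bitRow d s l) r) with hm₁
      have hI₁ : ExpandInv d i R W γ s y r ρ a m₁ := (hI.setNat le_rfl).setReal (Or.inl rfl)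
      have hfin : ∀ v, v = sgn (inner ℝ (bitRow d s l) r) →
          ExpandInv d i R W γ s y r ρ a ((m₁.setReal 9 l v).setNat 3
            ((m₁.setReal 9 l v).nat 3 + 1)) ∧
          ((m₁.setReal 9 l v).setNat 3 ((m₁.setReal 9 l v).nat 3 + 1)).nat 3 = l + 1 ∧
          (∀ l' < l + 1, ((m₁.setReal 9 l v).setNat 3
            ((m₁.setReal 9 l v).nat 3 + 1)).real 9 l' =
              sgn (inner ℝ (bitRow d s l') r)) := by
        rintro v rfl
        refine ⟨(hI₁.setReal (Or.inr rfl)).setNat (by norm_num), by simp [hm₁, hl], ?_⟩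
        intro l' hl'
        simp only [Mem.setNat_real, Mem.setReal_real, true_and]
        split_ifs with he
        · rw [he]
        · rw [hm₁, Mem.setReal_real_of_ne _ (by decide)]
          exact hs l' (by omega)
      have h6 : m₁.real 6 0 = inner ℝ (bitRow d s l) r := by simp [hm₁]
      have h3 : m₁.nat 3 = l := by simp [hm₁, hl]
      refine Runs.cond (fun hb => Runs.rset ?_) (fun hb => Runs.rset ?_)
      · simp only [Test.Holds, RExpr.eval, NExpr.eval, natR, h6] at hb
        simp only [RExpr.eval, NExpr.eval, natR, h3]
        refine (fun h => ⟨h.1, h.2.1, h.2.2, trivial⟩) (hfin _ ?_)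
        rw [sgn, if_pos (by simpa using hb)]
        norm_num
      · simp only [Test.Holds, RExpr.eval, NExpr.eval, natR, h6] at hb
        simp only [RExpr.eval, NExpr.eval, natR, h3]
        refine (fun h => ⟨h.1, h.2.1, h.2.2, trivial⟩) (hfin _ ?_)
        rw [sgn, if_neg (by simpa using hb)]
        norm_num
  · exact ⟨h.setNat (by norm_num), by simp, fun l hl => absurd hl (Nat.not_lt_zero l), rfl⟩
  · rintro m' k' ⟨hI, -, hs, rfl⟩
    exact hQ m' hI hs

/-- Overwriting the coordinates in place is harmless, since the signs in array 9 were all computed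
from the old residual. -/
theorem residCode_runs {H : ℕ → Empty → Mem → ℕ → ℝ → Prop} {k : ℕ} {Q : Mem → ℕ → Prop}
    (h : ExpandInv d i R W γ s y r ρ a m)
    (h9 : ∀ l < 2000 * d, m.real 9 l = sgn (inner ℝ (bitRow d s l) r))
    (hQ : ∀ m', ExpandInv d i R W γ s y (r - (ρ / (720 * (2000 * d : ℕ))) •
        ∑ l ∈ Finset.range (2000 * d), sgn (inner ℝ (bitRow d s l) r) • bitRow d s l) ρ a m' →
      (∀ l < 2000 * d, m'.real 9 l = sgn (inner ℝ (bitRow d s l) r)) → Q m' k) :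
    Runs H residCode m k (d * (3 * (2000 * d) + 6) + 2) Q := by
  set r' := r - (ρ / (720 * (2000 * d : ℕ))) •
        ∑ l ∈ Finset.range (2000 * d), sgn (inner ℝ (bitRow d s l) r) • bitRow d s l with hr'
  refine Runs.forRange (n := d) (T := 3 * (2000 * d) + 4)
    (I := fun j m' k' => QEnv d i R W γ s y m' ∧ m'.nat 2 = j ∧
      (∀ j' : Fin d, m'.real pointArr j' = if (j' : ℕ) < j then r' j' else r j') ∧
      m'.real 7 0 = ρ ∧ m'.real 8 0 = a ∧
      (∀ l < 2000 * d, m'.real 9 l = sgn (inner ℝ (bitRow d s l) r)) ∧ k' = k) ?_ ?_ ?_ ?_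
  · rintro j m' k' ⟨hI, hj, -⟩
    exact ⟨hj, by simp [NExpr.eval, hI.dim]⟩
  · rintro j m' k' hjd ⟨hI, hj, hv, h7, h8, hs, rfl⟩
    refine (Runs.seq (T₂ := 1) (Runs.sumTo (n := 2000 * d)
      (fun l => sgn (inner ℝ (bitRow d s l) r) * (2 * s (l * d + j) - 1)) ?_ ?_ ?_)).mono
      (by omega) fun _ _ h => h
    · intro l t
      simp [numRows, NExpr.eval, hI.dim]
    · intro l hl t
      rw [RExpr.eval, signEntry_eval (l' := l) (j' := j) (by simp [NExpr.eval])
        (by simp [NExpr.eval, hj])]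
      simp only [Mem.setReal_nat, Mem.setNat_nat, RExpr.eval, NExpr.eval]
      rw [Mem.setReal_real_of_ne _ (by decide), Mem.setReal_real_of_ne _ (by decide)]
      simp [hI.seed, hI.dim, hs l hl]
    · refine Runs.rset ?_
      simp only [RExpr.eval, NExpr.eval, numRows, natR]
      simp only [Mem.setReal_nat, Mem.setNat_nat, Mem.setReal_real, Mem.setNat_real, pointArr]
      simp only [hj, h7, hI.dim]
      norm_num
      have hj0 := hv ⟨j, hjd⟩
      simp only [lt_irrefl, if_false, pointArr] at hj0
      have hval : m'.real 3 j - ρ / (720 * (2000 * d)) * ∑ l ∈ Finset.range (2000 * d),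
          sgn (inner ℝ (bitRow d s l) r) * (2 * s (l * d + j) - 1) = r' ⟨j, hjd⟩ := by
        rw [hj0, hr']
        simp [bitRow]
      rw [hval]
      refine ⟨?_, ?_, h8, hs⟩
      · exact (((hI.setNat (by norm_num)).setReal (by decide) (by decide) (by decide)).setReal
          (by decide) (by decide) (by decide)).setNat le_rfl
      · intro j'
        by_cases he : (j' : ℕ) = j
        · have : j' = ⟨j, hjd⟩ := Fin.ext he
          simp [this]
        · have := hv j'
          simp only [pointArr] at this
          have h1 : ((j' : ℕ) ≤ j) = ((j' : ℕ) < j) := by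
            apply propext; omega
          simp [he, this, h1]
  · refine ⟨h.env.setNat le_rfl, by simp, fun j' => ?_, h.len, h.acc, h9, rfl⟩
    simpa using h.vec j'
  · rintro m' k' ⟨hI, -, hv, h7, h8, hs, rfl⟩
    refine hQ m' ⟨hI, fun j' => ?_, h7, h8⟩ hs
    rw [hv j', if_pos j'.2]

end codes

/-- A bound on the time of one step of the expansion. -/
def stepTime (d : ℕ) : ℕ := 12000 * d ^ 2 + 14006 * d + 6

/-- A bound on the time of a query whose expansion has `T` steps. -/
def codeTime (d T : ℕ) : ℕ := 3 * d + 4 + (T * (stepTime d + 1) + 4) + 1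

section codes

variable {d i T : ℕ} {R W γ y : ℝ} {s : ℕ → ℝ} {m : Mem}

/-- The stopping test involves only `γ`, `W` and the bound on the residual, so all examples take the
same number `T` of steps and the code computes one function `coef _ _ _ _ i T`. -/
theorem expandCode_runs {H : ℕ → Empty → Mem → ℕ → ℝ → Prop} {k : ℕ} {Q : Mem → ℕ → Prop}
    {x : EuclideanSpace ℝ (Fin d)} (h : QEnv d i R W γ s y m) (hx : IsVec m pointArr x)
    (hi : i < 2000 * d) (hT : ¬ γ < 32 * W * (R * shrink ^ T))
    (hlt : ∀ j < T, γ < 32 * W * (R * shrink ^ j))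
    (hQ : ∀ m' k', QEnv d i R W γ s y m' →
      m'.real 8 0 = coef (2000 * d) (bitRow d s) R x i T → Q m' k') :
    Runs H expandCode m k (T * (stepTime d + 1) + 3) Q := by
  have htest : ∀ m', QEnv d i R W γ s y m' → ((Test.realLt (.cell paramArr (.lit 2))
      (.mul (.mul (natR 32) (.cell paramArr (.lit 1))) (.cell 7 (.lit 0)))).Holds m' ↔
        γ < 32 * W * m'.real 7 0) := by
    intro m' hm'
    simp [Test.Holds, RExpr.eval, NExpr.eval, natR, hm'.margin, hm'.bound]
  have hloop := fun (m₀ : Mem) (k₀ : ℕ) (h₀ : ExpandInv d i R W γ s y x R 0 m₀) =>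
    Runs.loop (H := H) (m := m₀) (k := k₀) (c := .seq signsCode (.seq residCode coefStepCode))
    (b := .realLt (.cell paramArr (.lit 2))
          (.mul (.mul (natR 32) (.cell paramArr (.lit 1))) (.cell 7 (.lit 0))))
    (I := fun j m' _ => ExpandInv d i R W γ s y (resid (2000 * d) (bitRow d s) R x j)
      (R * shrink ^ j) (coef (2000 * d) (bitRow d s) R x i j) m' ∧ j ≤ T) (J := T)
    (T := stepTime d)
    (fun j m' _ hI hb => by
      rw [htest m' hI.1.env, hI.1.len] at hb
      rcases hI.2.lt_or_eq with h | h
      · exact h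
      · exact absurd (h ▸ hb) hT)
    (fun j m' k' hI hb => by
      have hjT : j < T := by
        rw [htest m' hI.1.env, hI.1.len] at hb
        rcases hI.2.lt_or_eq with h | h
        · exact h
        · exact absurd (h ▸ hb) hT
      refine (Runs.seq (signsCode_runs (Q := fun m₁ k₁ => Runs H (.seq residCode coefStepCode)
        m₁ k₁ (d * (3 * (2000 * d) + 6) + 2 + 2) _) hI.1 fun m₁ h₁ h₁s =>
        Runs.seq (residCode_runs h₁ h₁s fun m₂ h₂ h₂s => ?_))).mono
          (by unfold stepTime; ring_nf; omega) fun _ _ h => h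
      refine (Runs.seq (T₁ := 1) (T₂ := 1) (Runs.rset (Runs.rset ⟨?_, hjT⟩)))
      refine ⟨(h₂.env.setReal (by decide) (by decide) (by decide)).setReal (by decide)
        (by decide) (by decide), (h₂.vec.setReal (by decide)).setReal (by decide), ?_, ?_⟩
      · simp [RExpr.eval, NExpr.eval, natR, h₂.len, pow_succ, shrink, mul_assoc]
      · simp [RExpr.eval, NExpr.eval, h₂.len, h₂.acc, h₂.env.index, h₂s i hi, coef,
          Finset.sum_range_succ])
    (j := 0) ⟨by simpa [resid, coef] using h₀, Nat.zero_le _⟩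
  refine (Runs.seq (T₁ := 1) (Runs.rset (Runs.seq (T₁ := 1) (Runs.rset
    ((hloop _ _ ⟨(h.setReal (by decide) (by decide) (by decide)).setReal (by decide)
        (by decide) (by decide), (hx.setReal (by decide)).setReal (by decide), ?_, ?_⟩).mono
      le_rfl ?_))))).mono (by rw [Nat.sub_zero]; omega) fun _ _ h => h
  · simpa [RExpr.eval, NExpr.eval] using h.radius
  · simp [RExpr.eval, NExpr.eval, natR]
  · rintro m' k' ⟨j, ⟨hI, hj⟩, hb⟩
    rw [htest m' hI.env, hI.len] at hb
    have : j = T := by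
      rcases hj.lt_or_eq with h | h
      · exact absurd (hlt j h) hb
      · exact h
    subst this
    exact hQ m' k' hI.env hI.acc

theorem loadExample_env {z : Example d R} (h0 : m.nat 0 = d) (h1 : m.nat 1 = i)
    (hR : m.real paramArr 0 = R) (hW : m.real paramArr 1 = W) (hγ : m.real paramArr 2 = γ)
    (hs : m.real seedArr = s) : QEnv d i R W γ s (label z) (loadExample m z) := by
  refine ⟨h0, h1, ?_, ?_, ?_, ?_, ?_⟩ <;>
    simp [loadExample, Mem.setReal, Mem.setArray, paramArr, seedArr, labelArr, pointArr, label] <;>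
    assumption

theorem loadExample_point (m : Mem) (z : Example d R) :
    IsVec (loadExample m z) pointArr (z.1 : EuclideanSpace ℝ (Fin d)) := by
  intro j
  simp [loadExample, Mem.setReal, Mem.setArray, labelArr, pointArr, arrayOf]

theorem loadExample_out {w : EuclideanSpace ℝ (Fin d)} (hw : IsVec m outArr w)
    (z : Example d R) : IsVec (loadExample m z) outArr w := by
  intro j
  rw [← hw j]
  simp [loadExample, Mem.setReal, Mem.setArray, labelArr, pointArr, outArr]

theorem smallMargin_holds (h : QEnv d i R W γ s y m) :
    smallMargin.Holds m ↔ m.real 6 0 < γ / 2 := by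
  simp [smallMargin, Test.Holds, RExpr.eval, NExpr.eval, natR, h.margin]

theorem Runs.code_run {c : Code} {t : ℕ} {φ : ℝ}
    (h : Runs (fun _ _ _ _ _ => False) c m 0 t fun m' _ => m'.real valueArr 0 = φ) :
    ∃ t' ≤ t, ∃ m' : Mem, c.Run m t' m' ∧ m'.real valueArr 0 = φ := by
  obtain ⟨t', ht, m', k', he, hq⟩ := h
  obtain rfl := he.code_count
  exact ⟨t', ht, m', he, hq⟩

theorem errCode_runs {H : ℕ → Empty → Mem → ℕ → ℝ → Prop} {k : ℕ}
    {w : EuclideanSpace ℝ (Fin d)} {z : Example d R}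
    (h : QEnv d i R W γ s (label z) m) (hw : IsVec m outArr w)
    (hx : IsVec m pointArr (z.1 : EuclideanSpace ℝ (Fin d))) :
    Runs H errCode m k (codeTime d T) fun m' _ => m'.real valueArr 0 = errQuery γ w z := by
  refine (Runs.seq (T₂ := 2) (marginCode_runs h hw hx fun m' hm' _ h6 => ?_)).mono
    (by unfold codeTime; omega) fun _ _ h => h
  rw [← margin_eq] at h6
  refine Runs.cond (fun hb => Runs.rset ?_) (fun hb => Runs.rset ?_)
  · rw [smallMargin_holds hm', h6] at hb
    simp [RExpr.eval, NExpr.eval, natR, errQuery, hb]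
  · rw [smallMargin_holds hm', h6] at hb
    simp [RExpr.eval, NExpr.eval, natR, errQuery, hb]

theorem coefCode_runs {H : ℕ → Empty → Mem → ℕ → ℝ → Prop} {k : ℕ}
    {w : EuclideanSpace ℝ (Fin d)} {z : Example d R}
    (h : QEnv d i R W γ s (label z) m) (hw : IsVec m outArr w)
    (hx : IsVec m pointArr (z.1 : EuclideanSpace ℝ (Fin d)))
    (hi : i < 2000 * d) (hT : ¬ γ < 32 * W * (R * shrink ^ T))
    (hlt : ∀ j < T, γ < 32 * W * (R * shrink ^ j)) :
    Runs H coefCode m k (codeTime d T) fun m' _ =>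
      m'.real valueArr 0 = coefQuery (2000 * d) (bitRow d s) T γ w i z := by
  refine (Runs.seq (T₂ := T * (stepTime d + 1) + 4 + 1)
    (marginCode_runs h hw hx fun m' hm' hx' h6 => ?_)).mono
    (by unfold codeTime; omega) fun _ _ h => h
  rw [← margin_eq] at h6
  refine Runs.cond (fun hb => ?_) (fun hb => (Runs.rset ?_).mono (by omega) fun _ _ h => h)
  · rw [smallMargin_holds hm', h6] at hb
    refine Runs.seq (T₂ := 1) (expandCode_runs hm' hx' hi hT hlt fun m₁ k₁ h₁ h₁a => Runs.rset ?_)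
    simp [RExpr.eval, NExpr.eval, natR, coefQuery, hb, h₁.label, h₁.radius, h₁a]
  · rw [smallMargin_holds hm', h6] at hb
    simp [RExpr.eval, NExpr.eval, natR, coefQuery, hb]

end codes

/-! ### The main program -/

/-- Asks for all coefficients of the mean. -/
def askCoefs : SQProgram := forRange 1 numRows (.ask coefCode 12 (.reg 1))

/-- Adds a multiple of the estimated mean to the output vector. -/
def updateCode : SQProgram :=
  forRange 2 (.reg 0)
    (.seq (sumTo 6 3 numRows
        (.mul (.sub (.mul (natR 2) (.cell 12 (.reg 3))) (.cell 11 (.lit 0)))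
          (signEntry (.reg 3) (.reg 2))))
      (.rset outArr (.reg 2) (.add (.cell outArr (.reg 2))
        (.mul (.div (.div (.cell paramArr (.lit 2)) (.mul (natR 8)
            (.mul (.cell paramArr (.lit 0)) (.cell paramArr (.lit 0))))) (.cell 11 (.lit 0)))
          (.mul (.div (.mul (natR 500) (.cell paramArr (.lit 0)))
            (.mul (natR 3) (.ofNat numRows))) (.cell 6 (.lit 0)))))))

/-- The perceptron with statistical queries. -/
def perceptron : SQProgram :=
  .seq (.ask errCode 11 (.lit 0))
    (.loop (.realLt (.div (.cell paramArr (.lit 3)) (natR 2)) (.cell 11 (.lit 0)))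
      (.seq askCoefs (.seq updateCode (.ask errCode 11 (.lit 0)))))

/-- What the main program does not change. -/
structure PEnv (d : ℕ) (R W γ ε : ℝ) (s : ℕ → ℝ) (m : Mem) : Prop where
  dim : m.nat 0 = d
  radius : m.real paramArr 0 = R
  bound : m.real paramArr 1 = W
  margin : m.real paramArr 2 = γ
  accuracy : m.real paramArr 3 = ε
  seed : m.real seedArr = s

section main

variable {d T : ℕ} {R W γ ε : ℝ} {s : ℕ → ℝ} {m : Mem} {O : ℕ → (Example d R → ℝ) → ℝ}
  {k : ℕ} {w : EuclideanSpace ℝ (Fin d)}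

theorem PEnv.setNat (h : PEnv d R W γ ε s m) {r v : ℕ} (hr : r ≠ 0) :
    PEnv d R W γ ε s (m.setNat r v) :=
  ⟨by rw [Mem.setNat_nat, if_neg hr.symm, h.dim], h.radius, h.bound, h.margin, h.accuracy, h.seed⟩

theorem PEnv.setReal (h : PEnv d R W γ ε s m) {a c : ℕ} {v : ℝ} (h0 : paramArr ≠ a)
    (h1 : seedArr ≠ a) : PEnv d R W γ ε s (m.setReal a c v) := by
  constructor
  · exact h.dim
  · rw [Mem.setReal_real_of_ne _ h0, h.radius]
  · rw [Mem.setReal_real_of_ne _ h0, h.bound]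
  · rw [Mem.setReal_real_of_ne _ h0, h.margin]
  · rw [Mem.setReal_real_of_ne _ h0, h.accuracy]
  · rw [Mem.setReal_real_of_ne _ h1, h.seed]

theorem errCode_answers (h : PEnv d R W γ ε s m) (hw : IsVec m outArr w) (T k : ℕ) :
    Answers O k errCode m (codeTime d T) (O k (errQuery γ w)) :=
  ⟨errQuery γ w, errQuery_mem γ w, fun z => (errCode_runs (loadExample_env h.dim rfl h.radius
    h.bound h.margin h.seed) (loadExample_out hw z) (loadExample_point m z)).code_run, rfl⟩

theorem coefCode_answers (hR : 0 < R) (h : PEnv d R W γ ε s m) (hw : IsVec m outArr w)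
    (hi : m.nat 1 < 2000 * d) (hT : ¬ γ < 32 * W * (R * shrink ^ T))
    (hlt : ∀ j < T, γ < 32 * W * (R * shrink ^ j)) (k : ℕ) :
    Answers O k coefCode m (codeTime d T)
      (O k (coefQuery (2000 * d) (bitRow d s) T γ w (m.nat 1))) :=
  ⟨coefQuery (2000 * d) (bitRow d s) T γ w (m.nat 1),
    coefQuery_mem hR _ _ _ _ _ _, fun z => (coefCode_runs (loadExample_env h.dim rfl h.radius
    h.bound h.margin h.seed) (loadExample_out hw z) (loadExample_point m z) hi hT hlt).code_run,
    rfl⟩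

/-- The answers are recorded with their position `k + i`, as the oracle may depend on it. -/
theorem askCoefs_runs (hR : 0 < R) (hT : ¬ γ < 32 * W * (R * shrink ^ T))
    (hlt : ∀ j < T, γ < 32 * W * (R * shrink ^ j)) {v0 : ℝ} {Q : Mem → ℕ → Prop}
    (h : PEnv d R W γ ε s m) (hw : IsVec m outArr w) (h11 : m.real 11 0 = v0)
    (hQ : ∀ m', PEnv d R W γ ε s m' → IsVec m' outArr w → m'.real 11 0 = v0 →
      (∀ i < 2000 * d, m'.real 12 i =
        O (k + i) (coefQuery (2000 * d) (bitRow d s) T γ w i)) → Q m' (k + 2000 * d)) :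
    Runs (Answers O) askCoefs m k (2000 * d * (codeTime d T + 3) + 2) Q := by
  refine Runs.forRange (n := 2000 * d) (T := codeTime d T + 1)
    (I := fun j m' k' => PEnv d R W γ ε s m' ∧ m'.nat 1 = j ∧ IsVec m' outArr w ∧
      m'.real 11 0 = v0 ∧ (∀ i < j, m'.real 12 i =
        O (k + i) (coefQuery (2000 * d) (bitRow d s) T γ w i)) ∧ k' = k + j) ?_ ?_ ?_ ?_
  · rintro j m' k' ⟨hI, hj, -⟩
    exact ⟨hj, by simp [numRows, NExpr.eval, hI.dim]⟩
  · rintro j m' k' hjn ⟨hI, hj, hw', h11', h12, rfl⟩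
    have hans := coefCode_answers (O := O) hR hI hw' (hj ▸ hjn) hT hlt (k + j)
    rw [hj] at hans
    refine Runs.ask hans ⟨?_, ?_, ?_, ?_, ?_, by omega⟩
    · exact (hI.setReal (by decide) (by decide)).setNat (by decide)
    · simp [hj]
    · have hne : outArr ≠ 12 := by decide
      intro j'
      rw [Mem.setNat_real, Mem.setReal_real_of_ne _ hne, hw' j']
    · simpa using h11'
    · intro i hi
      simp only [NExpr.eval, hj, Mem.setNat_real, Mem.setReal_real, true_and]
      split_ifs with he
      · rw [he]
      · exact h12 i (by omega)
  · exact ⟨h.setNat (by decide), by simp, hw, h11, fun i hi => absurd hi (Nat.not_lt_zero i), rfl⟩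
  · rintro m' k' ⟨hI, -, hw', h11', h12, rfl⟩
    exact hQ m' hI hw' h11' h12

theorem updateCode_runs {v0 : ℝ} {v : ℕ → ℝ} {Q : Mem → ℕ → Prop}
    (h : PEnv d R W γ ε s m) (hw : IsVec m outArr w) (h11 : m.real 11 0 = v0)
    (h12 : ∀ i < 2000 * d, m.real 12 i = v i)
    (hQ : ∀ m', PEnv d R W γ ε s m' → IsVec m' outArr
      (w + (γ / (8 * R ^ 2) / v0) • estimate (2000 * d) (bitRow d s) R v0 v) → Q m' k) :
    Runs (Answers O) updateCode m k (d * (3 * (2000 * d) + 6) + 2) Q := by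
  set w' := w + (γ / (8 * R ^ 2) / v0) • estimate (2000 * d) (bitRow d s) R v0 v with hw'
  refine Runs.forRange (n := d) (T := 3 * (2000 * d) + 4)
    (I := fun j m' k' => PEnv d R W γ ε s m' ∧ m'.nat 2 = j ∧
      (∀ j' : Fin d, m'.real outArr j' = if (j' : ℕ) < j then w' j' else w j') ∧
      m'.real 11 0 = v0 ∧ (∀ i < 2000 * d, m'.real 12 i = v i) ∧ k' = k) ?_ ?_ ?_ ?_
  · rintro j m' k' ⟨hI, hj, -⟩
    exact ⟨hj, by simp [NExpr.eval, hI.dim]⟩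
  · rintro j m' k' hjd ⟨hI, hj, hv, h11', h12', rfl⟩
    refine (Runs.seq (T₂ := 1) (Runs.sumTo (n := 2000 * d)
      (fun l => (2 * v l - v0) * (2 * s (l * d + j) - 1)) ?_ ?_ ?_)).mono
      (by omega) fun _ _ h => h
    · intro l t
      simp [numRows, NExpr.eval, hI.dim]
    · intro l hl t
      rw [RExpr.eval, signEntry_eval (l' := l) (j' := j) (by simp [NExpr.eval])
        (by simp [NExpr.eval, hj])]
      simp only [Mem.setReal_nat, Mem.setNat_nat, RExpr.eval, NExpr.eval, natR]
      rw [Mem.setReal_real_of_ne _ (by decide), Mem.setReal_real_of_ne _ (by decide),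
        Mem.setReal_real_of_ne _ (by decide)]
      simp [hI.seed, hI.dim, h12' l hl, h11']
    · have hval : w ⟨j, hjd⟩ + γ / (8 * (R * R)) / v0 * (500 * R / (3 * (2000 * d)) *
          ∑ l ∈ Finset.range (2000 * d), (2 * v l - v0) * (2 * s (l * d + j) - 1)) =
            w' ⟨j, hjd⟩ := by
        rw [hw']
        simp only [PiLp.add_apply, PiLp.smul_apply, smul_eq_mul, estimate]
        congr 1
        rw [← pow_two]
        congr 1
        simp [bitRow, Finset.mul_sum, mul_assoc]
      have hj0 := hv ⟨j, hjd⟩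
      simp only [lt_irrefl, if_false] at hj0
      set m₁ := (m'.setNat 3 (2000 * d)).setReal 6 0 (∑ l ∈ Finset.range (2000 * d),
        (2 * v l - v0) * (2 * s (l * d + j) - 1)) with hm₁
      have hI₁ : PEnv d R W γ ε s m₁ := (hI.setNat (by decide)).setReal (by decide) (by decide)
      have e : (RExpr.add (.cell outArr (.reg 2))
        (.mul (.div (.div (.cell paramArr (.lit 2)) (.mul (natR 8)
            (.mul (.cell paramArr (.lit 0)) (.cell paramArr (.lit 0))))) (.cell 11 (.lit 0)))
          (.mul (.div (.mul (natR 500) (.cell paramArr (.lit 0)))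
            (.mul (natR 3) (.ofNat numRows))) (.cell 6 (.lit 0))))).eval m₁ = w' ⟨j, hjd⟩ := by
        rw [← hval]
        simp only [RExpr.eval, NExpr.eval, natR, numRows, hI₁.margin, hI₁.radius, hI₁.dim]
        have h6 : m₁.real 6 0 = ∑ l ∈ Finset.range (2000 * d),
          (2 * v l - v0) * (2 * s (l * d + j) - 1) := by simp [hm₁]
        have h2 : m₁.real outArr (m₁.nat 2) = w ⟨j, hjd⟩ := by
          rw [← hj0]; simp [hm₁, hj, outArr]
        have h11₁ : m₁.real 11 0 = v0 := by rw [← h11']; simp [hm₁]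
        rw [h6, h2, h11₁]
        push_cast
        rfl
      have hn2 : m₁.nat 2 = j := by simp [hm₁, hj]
      refine Runs.rset ?_
      rw [e]
      simp only [NExpr.eval, hn2]
      refine ⟨(hI₁.setReal (by decide) (by decide)).setNat (by decide), by simp [hn2], ?_, ?_, ?_,
        trivial⟩
      · intro j'
        simp only [Mem.setNat_real, Mem.setReal_real, true_and]
        by_cases he : (j' : ℕ) = j
        · have : j' = ⟨j, hjd⟩ := Fin.ext he
          simp [this]
        · rw [if_neg he, hm₁, Mem.setReal_real_of_ne _ (by decide), Mem.setNat_real, hv j']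
          have h1 : ((j' : ℕ) < j + 1) = ((j' : ℕ) < j) := by
            apply propext; omega
          simp only [h1]
      · rw [← h11']; simp [hm₁, outArr]
      · intro i hi
        rw [← h12' i hi]; simp [hm₁, outArr]
  · refine ⟨h.setNat (by decide), by simp, fun j' => ?_, h11, h12, rfl⟩
    simpa using hw j'
  · rintro m' k' ⟨hI, -, hv, -, -, rfl⟩
    refine hQ m' hI fun j' => ?_
    rw [hv j', if_pos j'.2]

end main

/-! ### Polynomial time bounds and the number of expansion steps -/

/-- A bound on the time of one iteration of the perceptron. -/
def bodyTime (d T : ℕ) : ℕ :=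
  2000 * d * (codeTime d T + 3) + 2 + (d * (3 * (2000 * d) + 6) + 2 + (codeTime d T + 1))

theorem codeTime_le {d T : ℕ} {X : ℝ} (hX : 1 ≤ X) (hd : (d : ℝ) ≤ X) (hT : T ≤ 3840001 * X) :
    (codeTime d T : ℝ) ≤ 2 * 10 ^ 11 * X ^ 3 := by
  have h1 : 1 ≤ X ^ 3 := one_le_pow₀ hX
  have h2 : X ^ 1 ≤ X ^ 3 := pow_le_pow_right₀ hX (by norm_num)
  have h3 : X ^ 2 ≤ X ^ 3 := pow_le_pow_right₀ hX (by norm_num)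
  calc (codeTime d T : ℝ)
      = 3 * d + 4 + (T * (12000 * d ^ 2 + 14006 * d + 6 + 1) + 4) + 1 := by
        simp [codeTime, stepTime]
    _ ≤ 3 * X + 4 + (3840001 * X * (12000 * X ^ 2 + 14006 * X + 6 + 1) + 4) + 1 := by gcongr
    _ ≤ _ := by linarith

theorem bodyTime_le {d T : ℕ} {X : ℝ} (hX : 1 ≤ X) (hd : (d : ℝ) ≤ X) (hT : T ≤ 3840001 * X) :
    (bodyTime d T : ℝ) ≤ 10 ^ 15 * X ^ 4 := by
  have h1 : 1 ≤ X ^ 4 := one_le_pow₀ hX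
  have h2 : X ^ 1 ≤ X ^ 4 := pow_le_pow_right₀ hX (by norm_num)
  have h3 : X ^ 2 ≤ X ^ 4 := pow_le_pow_right₀ hX (by norm_num)
  have h4 : X ^ 3 ≤ X ^ 4 := pow_le_pow_right₀ hX (by norm_num)
  have hc := codeTime_le hX hd hT
  calc (bodyTime d T : ℝ)
      = 2000 * d * (codeTime d T + 3) + 2 + (d * (3 * (2000 * d) + 6) + 2 +
          (codeTime d T + 1)) := by simp [bodyTime]
    _ ≤ 2000 * X * (2 * 10 ^ 11 * X ^ 3 + 3) + 2 + (X * (3 * (2000 * X) + 6) + 2 +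
          (2 * 10 ^ 11 * X ^ 3 + 1)) := by gcongr
    _ ≤ _ := by linarith

theorem totalTime_le {d T J : ℕ} {X : ℝ} (hX : 1 ≤ X) (hd : (d : ℝ) ≤ X) (hT : T ≤ 3840001 * X)
    (hJ : J ≤ 33 * X ^ 2) :
    ((codeTime d T + 1 + (J * (bodyTime d T + 1) + 1) : ℕ) : ℝ) ≤ 10 ^ 17 * X ^ 6 := by
  have h1 : 1 ≤ X ^ 6 := one_le_pow₀ hX
  have h3 : X ^ 2 ≤ X ^ 6 := pow_le_pow_right₀ hX (by norm_num)
  have h4 : X ^ 3 ≤ X ^ 6 := pow_le_pow_right₀ hX (by norm_num)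
  have hc := codeTime_le hX hd hT
  have hb := bodyTime_le hX hd hT
  push_cast
  calc (codeTime d T : ℝ) + 1 + (J * (bodyTime d T + 1) + 1)
      ≤ 2 * 10 ^ 11 * X ^ 3 + 1 + (33 * X ^ 2 * (10 ^ 15 * X ^ 4 + 1) + 1) := by gcongr
    _ ≤ _ := by linarith

/-- The number of steps after which the residual is negligible. -/
theorem exists_shrink_steps {κ : ℝ} (hκ : 1 ≤ κ) {R W γ : ℝ} (hγ : 0 < γ)
    (hWR : W * R = κ * γ) :
    ∃ T : ℕ, ¬ γ < 32 * W * (R * shrink ^ T) ∧ (∀ j < T, γ < 32 * W * (R * shrink ^ j)) ∧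
      (T : ℝ) ≤ 3840000 * κ + 1 := by
  have hκ0 : 0 < κ := by linarith
  set T₀ := ⌈3840000 * κ⌉₊ with hT₀
  have h0 : ¬ γ < 32 * W * (R * shrink ^ T₀) := by
    -- Bernoulli's inequality replaces logarithms: `(1 + 1 / 120000) ^ T₀` is at least `32 κ`
    -- because `3840000 = 32 * 120000`.
    have h1 : shrink ^ T₀ * (1 + 1 / 120000) ^ T₀ ≤ 1 := by
      rw [← mul_pow]
      exact pow_le_one₀ (by unfold shrink; norm_num) (by unfold shrink; norm_num)
    have h2 := one_add_mul_le_pow (show (-2 : ℝ) ≤ 1 / 120000 by norm_num) T₀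
    have h3 : 3840000 * κ ≤ T₀ := Nat.le_ceil _
    have h4 : 32 * κ ≤ (1 + 1 / 120000) ^ T₀ := by linarith
    have h5 : shrink ^ T₀ * (32 * κ) ≤ 1 :=
      (mul_le_mul_of_nonneg_left h4 (pow_nonneg shrink_pos.le _)).trans h1
    have h6 : 32 * W * (R * shrink ^ T₀) = shrink ^ T₀ * (32 * κ) * γ := by
      linear_combination 32 * shrink ^ T₀ * hWR
    rw [not_lt, h6]
    exact mul_le_of_le_one_left hγ.le h5
  classical
  have hex : ∃ T : ℕ, ¬ γ < 32 * W * (R * shrink ^ T) := ⟨T₀, h0⟩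
  -- The loop stops at the first index at which its test fails, hence the minimal one.
  refine ⟨Nat.find hex, Nat.find_spec hex, fun j hj => not_not.1 (Nat.find_min hex hj), ?_⟩
  have h1 : (Nat.find hex : ℝ) ≤ T₀ := Nat.cast_le.2 (Nat.find_min' hex h0)
  exact h1.trans (Nat.ceil_lt_add_one (by positivity)).le

theorem initMem_env (d : ℕ) (R W γ ε : ℝ) {l : ℕ} (seed : Fin l → Bool) :
    PEnv d R W γ ε (bitCells seed) (initMem d R W γ ε seed) := by
  constructor <;> try simp [initMem, paramArr]
  funext i
  simp [seedArr, bitCells]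

theorem initMem_out (d : ℕ) (R W γ ε : ℝ) {l : ℕ} (seed : Fin l → Bool) :
    IsVec (initMem d R W γ ε seed) outArr (0 : EuclideanSpace ℝ (Fin d)) := by
  intro j
  simp [initMem, outArr, paramArr, seedArr]

section main

variable {d T : ℕ} {R W γ ε : ℝ} {s : ℕ → ℝ} {O : ℕ → (Example d R → ℝ) → ℝ}
  {wstar : EuclideanSpace ℝ (Fin d)}

/-- The invariant of the main loop after `j` iterations. -/
def PerceptronInv (W ε : ℝ) (s : ℕ → ℝ) (O : ℕ → (Example d R → ℝ) → ℝ) (γ : ℝ)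
    (wstar : EuclideanSpace ℝ (Fin d)) (j : ℕ) (m : Mem) (k : ℕ) : Prop :=
  PEnv d R W γ ε s m ∧ k = j * (2000 * d + 1) + 1 ∧ ∃ w : EuclideanSpace ℝ (Fin d),
    IsVec m outArr w ∧ m.real 11 0 = O (j * (2000 * d + 1)) (errQuery γ w) ∧
    ‖w - wstar‖ ^ 2 ≤ W ^ 2 - j * (γ ^ 2 / (32 * R ^ 2))

/-- A passed test gives `p ≥ ε / 4`, so all answers of the round have error at most `θ p` with `θ =
1 / (500000 κ)`, as the progress estimate needs. -/
theorem PerceptronInv.body_runs (D : Measure (Example d R)) [IsProbabilityMeasure D] {n : ℕ}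
    (hO : IsVSTAT D n O) (hd : 1 ≤ d) (hR : 0 < R) (hW : 0 < W) (hγ : 0 < γ) (hε : 0 < ε)
    (hκ : 1 ≤ W * R / γ) (hn : 10 ^ 12 * (W * R / γ) ^ 2 / ε ≤ n)
    (hb : IsKashin (2000 * d) (bitRow d s)) (hstar : ∀ᵐ z ∂D, γ ≤ SQ.margin wstar z)
    (hT : ¬ γ < 32 * W * (R * shrink ^ T)) (hlt : ∀ j < T, γ < 32 * W * (R * shrink ^ j))
    {j k : ℕ} {m : Mem} (hI : PerceptronInv W ε s O γ wstar j m k)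
    (htest : ε / 2 < m.real 11 0) :
    Runs (Answers O) (.seq askCoefs (.seq updateCode (.ask errCode 11 (.lit 0)))) m k
      (bodyTime d T) (PerceptronInv W ε s O γ wstar (j + 1)) := by
  obtain ⟨henv, rfl, w, hw, h11, hdist⟩ := hI
  set p := ∫ z, errQuery γ w z ∂D with hp
  have hv0 := hO (j * (2000 * d + 1)) (errQuery γ w) (measurable_errQuery γ w) (errQuery_mem γ w)
  rw [← hp, ← h11] at hv0
  have hp0 : 0 ≤ p := integral_nonneg fun z => (errQuery_mem γ w z).1
  have hpε := quarter_le_of_answer hκ hε hn hp0 hv0 htest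
  have hκ0 : 0 < W * R / γ := by linarith
  refine (Runs.seq (askCoefs_runs hR hT hlt henv hw rfl fun m₁ h₁ hw₁ h₁₁ h₁₂ =>
    Runs.seq (updateCode_runs h₁ hw₁ h₁₁ h₁₂ fun m₂ h₂ hw₂ =>
      Runs.ask (errCode_answers (O := O) h₂ hw₂ T _) ?_))).mono
      (by unfold bodyTime; omega) fun _ _ h => h
  refine ⟨h₂.setReal (by decide) (by decide), by ring, _, IsVec.setReal hw₂ (by decide), ?_, ?_⟩
  · simp only [Mem.setReal_real, NExpr.eval, and_self, if_true]
    congr 1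
    ring
  · have hstep := norm_perceptron_step_le D hR hγ hW ((one_le_div hγ).1 hκ) (by omega) hb
      (not_lt.1 hT) hstar (w := w) ?_ (v0 := m.real 11 0)
      (v := fun i => O (j * (2000 * d + 1) + 1 + i)
        (coefQuery (2000 * d) (bitRow d s) T γ w i)) (θ := 1 / (500000 * (W * R / γ)))
      (by positivity) (le_of_eq (by field_simp)) (by linarith)
      (hv0.trans (tolerance_le hκ hε hn hpε hp0 le_rfl)) ?_
    · push_cast
      linarith
    -- The distance to `wstar` never exceeds its initial bound `W`.
    · refine abs_le_of_sq_le_sq' ?_ hW.le |>.2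
      have : 0 ≤ j * (γ ^ 2 / (32 * R ^ 2)) := by positivity
      linarith
    · intro i _
      refine (hO _ _ (measurable_coefQuery _ _ _ _ _ _) (coefQuery_mem hR _ _ _ _ _ _)).trans ?_
      refine tolerance_le hκ hε hn hpε
        (integral_nonneg fun z => (coefQuery_mem hR _ _ _ _ _ _ z).1) ?_
      exact integral_mono (integrable_coefQuery D hR _ _ _ _ _ _) (integrable_errQuery D γ w)
        fun z => (coefQuery_nonneg_le hR _ _ _ _ _ _ z).2

/-- Nonnegativity of the squared distance in the invariant caps the iterations at `32 κ²`, which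
yields termination and the query count; the failed test at the end yields accuracy. -/
theorem perceptron_runs (D : Measure (Example d R)) [IsProbabilityMeasure D] {n : ℕ}
    (hO : IsVSTAT D n O) (hd : 1 ≤ d) (hR : 0 < R) (hW : 0 < W) (hγ : 0 < γ) (hε : 0 < ε)
    (hκ : 1 ≤ W * R / γ) (hn : 10 ^ 12 * (W * R / γ) ^ 2 / ε ≤ n)
    (hstar : ∀ᵐ z ∂D, γ ≤ SQ.margin wstar z) (hnorm : ‖wstar‖ ≤ W)
    (hT : ¬ γ < 32 * W * (R * shrink ^ T)) (hlt : ∀ j < T, γ < 32 * W * (R * shrink ^ j))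
    {l : ℕ} {seed : Fin l → Bool} (hb : IsKashin (2000 * d) (bitRow d (bitCells seed)))
    {J : ℕ} (hJ : 32 * (W * R / γ) ^ 2 < J) :
    ∃ (t q : ℕ) (w : EuclideanSpace ℝ (Fin d)), Outputs perceptron W γ ε seed O t q w ∧
      D.real {z | SQ.margin w z < γ / 2} ≤ ε ∧
      (q : ℝ) ≤ 32 * (W * R / γ) ^ 2 * (2000 * d + 1) + 1 ∧
      t ≤ codeTime d T + 1 + (J * (bodyTime d T + 1) + 1) := by
  have hcount : ∀ j m k, PerceptronInv W ε (bitCells seed) O γ wstar j m k →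
      (j : ℝ) ≤ 32 * (W * R / γ) ^ 2 := by
    rintro j m k ⟨-, -, w, -, -, hw⟩
    have h1 : j * (γ ^ 2 / (32 * R ^ 2)) ≤ W ^ 2 := by linarith [sq_nonneg ‖w - wstar‖]
    have h2 : (j : ℝ) = j * (γ ^ 2 / (32 * R ^ 2)) * (32 * R ^ 2 / γ ^ 2) := by field_simp
    have h3 : 32 * (W * R / γ) ^ 2 = W ^ 2 * (32 * R ^ 2 / γ ^ 2) := by ring
    rw [h2, h3]
    exact mul_le_mul_of_nonneg_right h1 (by positivity)
  have htest : ∀ m, PEnv d R W γ ε (bitCells seed) m →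
      ((Test.realLt (.div (.cell paramArr (.lit 3)) (natR 2)) (.cell 11 (.lit 0))).Holds m ↔
        ε / 2 < m.real 11 0) := by
    intro m hm
    simp [Test.Holds, RExpr.eval, NExpr.eval, natR, hm.accuracy]
  have henv := initMem_env d R W γ ε seed
  have hout := initMem_out d R W γ ε seed
  have hrun : Runs (Answers O) perceptron (initMem d R W γ ε seed) 0
      (codeTime d T + 1 + ((J - 0) * (bodyTime d T + 1) + 1)) fun m' k' =>
        ∃ j, PerceptronInv W ε (bitCells seed) O γ wstar j m' k' ∧
          ¬ (Test.realLt (.div (.cell paramArr (.lit 3)) (natR 2)) (.cell 11 (.lit 0))).Holds m' := by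
    refine Runs.seq (Runs.ask (errCode_answers (O := O) henv hout T 0) (Runs.loop ?_ ?_ ?_))
    · intro j m k hI _
      have := (hcount j m k hI).trans_lt hJ
      exact_mod_cast this
    · intro j m k hI hbt
      rw [htest m hI.1] at hbt
      exact hI.body_runs D hO hd hR hW hγ hε hκ hn hb hstar hT hlt hbt
    · refine ⟨henv.setReal (by decide) (by decide), by ring, 0,
        IsVec.setReal hout (by decide), by simp [NExpr.eval], ?_⟩
      rw [zero_sub, norm_neg]
      have := pow_le_pow_left₀ (norm_nonneg wstar) hnorm 2
      simpa using this
  obtain ⟨t, ht, m', q, he, j, hI, hbt⟩ := hrun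
  have hj := hcount j m' q hI
  rw [htest m' hI.1, not_lt] at hbt
  obtain ⟨-, rfl, w, hw, h11, -⟩ := hI
  refine ⟨t, _, w, ⟨m', he, fun i => (hw i).symm⟩, ?_, ?_, ht⟩
  · rw [← integral_errQuery]
    have hv0 := hO (j * (2000 * d + 1)) (errQuery γ w) (measurable_errQuery γ w)
      (errQuery_mem γ w)
    rw [← h11] at hv0
    exact le_of_answer_le hκ hε hn (integral_nonneg fun z => (errQuery_mem γ w z).1) hv0 hbt
  · push_cast
    gcongr

end main

/-! ### Assembly -/

/-- A single example with the margin, which exists as `D` is a probability measure, supplies `κ ≥ 1`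
and the positivity of `R` and `W`. -/
theorem margin_bound_of_ae {d : ℕ} {R W γ : ℝ} (D : Measure (Example d R))
    [IsProbabilityMeasure D] {wstar : EuclideanSpace ℝ (Fin d)} (hnorm : ‖wstar‖ ≤ W)
    (hstar : ∀ᵐ z ∂D, γ ≤ SQ.margin wstar z) : γ ≤ ‖wstar‖ * R ∧ ‖wstar‖ * R ≤ W * R ∧ 0 ≤ R := by
  obtain ⟨z, hz⟩ := hstar.exists
  have hR : 0 ≤ R := (norm_nonneg _).trans (norm_example_le z)
  exact ⟨hz.trans ((le_abs_self _).trans (abs_margin_le wstar z)),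
    mul_le_mul_of_nonneg_right hnorm hR, hR⟩

theorem perceptron_correct (C : ℕ) (hC : 10 ^ 17 ≤ C) (d : ℕ) :
    ∃ good : Finset (Fin (C * d ^ C) → Bool),
      (2 / 3 : ℝ) * 2 ^ (C * d ^ C) ≤ (good.card : ℝ) ∧
      ∀ seed ∈ good, ∀ (R W γ ε : ℝ), 0 < γ → 0 < ε →
        ∀ (D : Measure (Example d R)) [IsProbabilityMeasure D],
          (∃ wstar : EuclideanSpace ℝ (Fin d),
            ‖wstar‖ ≤ W ∧ ∀ᵐ z ∂D, γ ≤ SQ.margin wstar z) →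
          ∀ O : ℕ → (Example d R → ℝ) → ℝ,
            IsVSTAT D ⌈(C : ℝ) * (W * R / γ) ^ 2 / ε⌉₊ O →
            ∃ (t q : ℕ) (w : EuclideanSpace ℝ (Fin d)),
              Outputs perceptron W γ ε seed O t q w ∧
              D.real {z | SQ.margin w z < γ / 2} ≤ ε ∧
              (q : ℝ) ≤ C * d * (W * R / γ) ^ 2 ∧
              (t : ℝ) ≤ C * (d + W * R / γ + 1 / ε) ^ C := by
  -- In dimension zero no vector has positive margin, so every string is good vacuously.
  rcases Nat.eq_zero_or_pos d with rfl | hd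
  · refine ⟨Finset.univ, ?_, ?_⟩
    · rw [Finset.card_univ, Fintype.card_fun, Fintype.card_bool, Fintype.card_fin]
      push_cast
      exact mul_le_of_le_one_left (by positivity) (by norm_num)
    · rintro seed - R W γ ε hγ - D _ ⟨wstar, hnorm, hstar⟩
      have h := (margin_bound_of_ae D hnorm hstar).1
      rw [Subsingleton.elim wstar 0, norm_zero, zero_mul] at h
      exact absurd hγ (not_lt.2 h)
  · have hl : 2000 * d * d ≤ C * d ^ C := by
      rw [mul_assoc, ← pow_two]
      exact Nat.mul_le_mul (by omega) (Nat.pow_le_pow_right hd (by omega))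
    obtain ⟨good, hcard, hgood⟩ := exists_good_seeds hd le_rfl hl
    refine ⟨good, hcard, ?_⟩
    rintro seed hseed R W γ ε hγ hε D _ ⟨wstar, hnorm, hstar⟩ O hO
    obtain ⟨h1, h2, hR0⟩ := margin_bound_of_ae D hnorm hstar
    have hWR : γ ≤ W * R := h1.trans h2
    have hR : 0 < R := hR0.lt_of_ne fun h => by
      rw [← h, mul_zero] at hWR; linarith
    have hW : 0 < W := pos_of_mul_pos_left (hγ.trans_le hWR) hR0
    have hκ : 1 ≤ W * R / γ := (one_le_div hγ).2 hWR
    have hCr : (10 : ℝ) ^ 17 ≤ C := by exact_mod_cast hC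
    have hn : 10 ^ 12 * (W * R / γ) ^ 2 / ε ≤ (⌈(C : ℝ) * (W * R / γ) ^ 2 / ε⌉₊ : ℝ) := by
      refine le_trans ?_ (Nat.le_ceil _)
      gcongr
      linarith
    obtain ⟨T, hT, hlt, hTle⟩ := exists_shrink_steps hκ hγ (W := W) (R := R)
      (by field_simp)
    have hJ : 32 * (W * R / γ) ^ 2 < (⌊32 * (W * R / γ) ^ 2⌋₊ + 1 : ℕ) := by
      push_cast
      exact Nat.lt_floor_add_one _
    obtain ⟨t, q, w, hw, herr, hq, ht⟩ := perceptron_runs D hO hd hR hW hγ hε hκ hn hstar hnorm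
      hT hlt (hgood seed hseed) hJ
    have hd1 : (1 : ℝ) ≤ d := by exact_mod_cast hd
    have hε' : 0 < 1 / ε := by positivity
    set κ := W * R / γ with hκdef
    have hκ2 : 1 ≤ κ ^ 2 := one_le_pow₀ hκ
    refine ⟨t, q, w, hw, herr, hq.trans ?_, ?_⟩
    -- The count `32 κ² (2000 d + 1) + 1` is at most `64033 d κ²`.
    · have h3 : 1 ≤ d * κ ^ 2 := by nlinarith
      have h4 : κ ^ 2 ≤ d * κ ^ 2 := le_mul_of_one_le_left (by positivity) hd1
      have h5 : 10 ^ 17 * (d * κ ^ 2) ≤ C * (d * κ ^ 2) :=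
        mul_le_mul_of_nonneg_right hCr (by positivity)
      linarith
    · set X := d + κ + 1 / ε with hX
      have hX1 : 1 ≤ X := by linarith
      have hκX : κ ≤ X := by linarith
      have hκX2 : κ ^ 2 ≤ X ^ 2 := pow_le_pow_left₀ (by linarith) hκX 2
      have hJX : ((⌊32 * κ ^ 2⌋₊ + 1 : ℕ) : ℝ) ≤ 33 * X ^ 2 := by
        push_cast
        have := Nat.floor_le (show 0 ≤ 32 * κ ^ 2 by positivity)
        linarith
      have h3 := totalTime_le hX1 (by linarith) (T := T) (d := d) (by linarith) hJX
      calc (t : ℝ) ≤ _ := Nat.cast_le.2 ht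
        _ ≤ 10 ^ 17 * X ^ 6 := h3
        _ ≤ C * X ^ C := mul_le_mul hCr (pow_le_pow_right₀ hX1 (by omega)) (by positivity)
            (by positivity)

end SQ

theorem mainTheorem12 :
    ∃ (P : SQ.SQProgram) (C : ℕ), ∀ d : ℕ,
      ∃ good : Finset (Fin (C * d ^ C) → Bool),
        (2 / 3 : ℝ) * 2 ^ (C * d ^ C) ≤ (good.card : ℝ) ∧
        ∀ seed ∈ good, ∀ (R W γ ε : ℝ), 0 < γ → 0 < ε →
          ∀ (D : Measure (SQ.Example d R)) [IsProbabilityMeasure D],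
            (∃ wstar : EuclideanSpace ℝ (Fin d),
              ‖wstar‖ ≤ W ∧ ∀ᵐ z ∂D, γ ≤ SQ.margin wstar z) →
            ∀ O : ℕ → (SQ.Example d R → ℝ) → ℝ,
              SQ.IsVSTAT D ⌈(C : ℝ) * (W * R / γ) ^ 2 / ε⌉₊ O →
              ∃ (t q : ℕ) (w : EuclideanSpace ℝ (Fin d)),
                SQ.Outputs P W γ ε seed O t q w ∧
                D.real {z | SQ.margin w z < γ / 2} ≤ ε ∧
                (q : ℝ) ≤ C * d * (W * R / γ) ^ 2 ∧
                (t : ℝ) ≤ C * (d + W * R / γ + 1 / ε) ^ C := by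
  -- The constant stays opaque: only its lower bound is used, and `d ^ C` is never unfolded.
  obtain ⟨C, hC⟩ : ∃ C : ℕ, 10 ^ 17 ≤ C := ⟨_, le_rfl⟩
  exact ⟨SQ.perceptron, C, SQ.perceptron_correct C hC⟩
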